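/- **Setting.** LTL formulas over a set $Ap$ of atomic propositions are in negation normal form, built from $\mathbf{tt},\mathbf{ff},a,\neg a$ ($a\in Ap$) with $\wedge,\vee,\mathbf X,\mathbf F,\mathbf G,\mathbf U,\mathbf W$ (weak until), $\mathbf M$ (strong release), $\mathbf R$, and are interpreted as usual over $\omega$-words $w=w[0]w[1]\cdots$ over $2^{Ap}$; $w_{0i}=w[0]\cdots w[i-1]$, $w_i=w[i]w[i+1]\cdots$, and $L(\varphi)=\{w\mid w\models\varphi\}$. The length of $\varphi$ is the number of nodes of its syntax tree, whose leaves are constants and literals. A subformula is proper if its root is a literal or a temporal operator. $\varphi\equiv_P\psi$ means that the propositional formulas obtained by replacing each maximal proper subformula $\chi$ by a variable $x_\chi$ are equivalent; below, automaton states are formulas modulo $\equiv_P$. The formula $\mathit{af}(\varphi,\nu)$, for a letter $\nu\subseteq Ap$, is defined by: $\mathit{af}(\mathbf{tt},\nu)=\mathbf{tt}$; $\mathit{af}(\mathbf{ff},\nu)=\mathbf{ff}$; $\mathit{af}(a,\nu)=\mathbf{tt}$ if $a\in\nu$, else $\mathbf{ff}$; $\mathit{af}(\neg a,\nu)=\mathbf{ff}$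 if $a\in\nu$, else $\mathbf{tt}$; $\mathit{af}$ commutes with $\wedge,\vee$; $\mathit{af}(\mathbf X\varphi,\nu)=\varphi$; $\mathit{af}(\mathbf F\varphi,\nu)=\mathit{af}(\varphi,\nu)\vee\mathbf F\varphi$; $\mathit{af}(\mathbf G\varphi,\nu)=\mathit{af}(\varphi,\nu)\wedge\mathbf G\varphi$; $\mathit{af}(\varphi\,\mathit{op}\,\psi,\nu)=\mathit{af}(\psi,\nu)\vee(\mathit{af}(\varphi,\nu)\wedge\varphi\,\mathit{op}\,\psi)$ for $\mathit{op}\in\{\mathbf U,\mathbf W\}$; $\mathit{af}(\varphi\,\mathit{op}\,\psi,\nu)=\mathit{af}(\psi,\nu)\wedge(\mathit{af}(\varphi,\nu)\vee\varphi\,\mathit{op}\,\psi)$ for $\mathit{op}\in\{\mathbf M,\mathbf R\}$. It is extended to finite words letter by letter, and $\mathit{Reach}(\varphi)=\{[\mathit{af}(\varphi,u)]_P\mid u \text{ a finite word}\}$. $\mu(\varphi)$ is the set of subformulas of $\varphi$ with root $\mathbf F,\mathbf U$ or $\mathbf M$, and $\nu(\varphi)$ the set of those with root $\mathbf G,\mathbf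 W$ or $\mathbf R$. The formula $\varphi[X]_\nu$ is obtained by commuting with all constructors except: $(\mathbf F\psi)[X]_\nu=\mathbf{tt}$, $(\psi_1\mathbf U\psi_2)[X]_\nu=\psi_1[X]_\nu\,\mathbf W\,\psi_2[X]_\nu$, $(\psi_1\mathbf M\psi_2)[X]_\nu=\psi_1[X]_\nu\,\mathbf R\,\psi_2[X]_\nu$ if the formula in question belongs to $X$, and $\mathbf{ff}$ otherwise. The formula $\varphi[Y]_\mu$ is obtained by commuting with all constructors except: a formula with root $\mathbf G,\mathbf W,\mathbf R$ that belongs to $Y$ becomes $\mathbf{tt}$; otherwise $(\mathbf G\psi)[Y]_\mu=\mathbf{ff}$, $(\psi_1\mathbf W\psi_2)[Y]_\mu=\psi_1[Y]_\mu\,\mathbf U\,\psi_2[Y]_\mu$, $(\psi_1\mathbf R\psi_2)[Y]_\mu=\psi_1[Y]_\mu\,\mathbf M\,\psi_2[Y]_\mu$. Put $$L^1_{X,Y}=\{w\mid\exists i.\ w_i\models \mathit{af}(\varphi,w_{0i})[X]_\nu\},\quad L^2_{X,Y}=\{w\mid\forall\psi\in X.\ w\models\mathbf{GF}(\psi[Y]_\mu)\},\quad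 L^3_{X,Y}=\{w\mid\forall\psi\in Y.\ w\models\mathbf{FG}(\psi[X]_\nu)\}.$$ Automata have finitely many states. A DBA (DCA) is a deterministic $\omega$-automaton with accepting condition $\inf(S)$ ($\mathit{fin}(S)$): the run visits $S$ infinitely often (finitely often). A DRA with $k\ge1$ Rabin pairs has the condition $\bigvee_{i=1}^k(\inf(I_i)\wedge\mathit{fin}(F_i))$. **Construction.** Let $X\subseteq\mu(\varphi)$, $Y\subseteq\nu(\varphi)$. * $\mathcal C_{\varphi,X}$ has state set $\mathit{Reach}(\varphi)\times\bigcup_{\psi\in\mathit{Reach}(\varphi)}\mathit{Reach}(\psi[X]_\nu)$, initial state $(\varphi,\varphi[X]_\nu)$, transitions $\delta((\xi,\zeta),\nu)=(\mathit{af}(\xi,\nu),\mathit{af}(\xi[X]_\nu,\nu))$ if $\zeta\equiv_P\mathbf{ff}$ and $(\mathit{af}(\xi,\nu),\mathit{af}(\zeta,\nu))$ otherwise, and condition $\mathit{fin}(\mathit{Reach}(\varphi)\times\{\mathbf{ff}\})$. * $\mathcal B_{X,Y}$ is the intersection (product with a cyclic counter ranging over $\max(1,|X|)$ values) of the deterministic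 Büchi automata, for $\psi\in X$, with state set $\mathit{Reach}(\mathbf F(\psi[Y]_\mu))$, initial state $\mathbf F(\psi[Y]_\mu)$, transitions $\mathit{af}$ except that every transition from $\mathbf{tt}$ leads to the initial state, and condition $\inf(\{\mathbf{tt}\})$. * $\mathcal D_{X,Y}$ is the product of the deterministic coBüchi automata, for $\psi\in Y$, with state set $\mathit{Reach}(\mathbf G(\psi[X]_\nu))$, initial state $\mathbf G(\psi[X]_\nu)$, transitions $\mathit{af}$ except that every transition from $\mathbf{ff}$ leads to the initial state, and condition $\mathit{fin}(\{\mathbf{ff}\})$; its condition is that the states with some component $\mathbf{ff}$ are visited finitely often. * $A_{X,Y}$ is the product of $\mathcal C_{\varphi,X}$, $\mathcal B_{X,Y}$, $\mathcal D_{X,Y}$, with the conjunction of their three accepting conditions, written as a single Rabin pair. * $A_\varphi$ is the product of the automata $A_{X,Y}$ over all pairs $X\subseteq\mu(\varphi)$, $Y\subseteq\nu(\varphi)$, with the disjunction of their Rabin pairs (each lifted to the product). **Theorem.** There is an absolute constant $C$ such that for every $Ap$ and every LTL formula $\varphi$ over $Ap$, of length $n$: 1. For all $X\subseteq\mu(\varphi)$,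 $Y\subseteq\nu(\varphi)$: $\mathcal C_{\varphi,X}$ is a DCA recognizing $L^1_{X,Y}$ with at most $(2^{2^n})^2$ states; $\mathcal B_{X,Y}$ is a DBA recognizing $L^2_{X,Y}$ and $\mathcal D_{X,Y}$ is a DCA recognizing $L^3_{X,Y}$, each with at most $2^{2^{Cn}}$ states; and $A_{X,Y}$ is a DRA with one Rabin pair recognizing $L^1_{X,Y}\cap L^2_{X,Y}\cap L^3_{X,Y}$, with at most $2^{2^{Cn}}$ states. 2. $A_\varphi$ is a DRA with at most $2^n$ Rabin pairs and at most $2^{2^{Cn}}$ states, its language is $\bigcup_{X\subseteq\mu(\varphi),\,Y\subseteq\nu(\varphi)}L(A_{X,Y})$, and it recognizes $L(\varphi)$. -/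

import Mathlib

universe u v

noncomputable section

open scoped Classical

/-! ## Omega-words and omega-automata -/

/-- The infinite suffix `w[i] w[i+1] ...` of an omega-word. -/
def wordSuffix {A : Type u} (w : ℕ → A) (i : ℕ) : ℕ → A := fun k => w (i + k)

/-- The finite prefix `w[0] ... w[i-1]` of an omega-word. -/
def wordPrefix {A : Type u} (w : ℕ → A) (i : ℕ) : List A := (List.range i).map w

/-- Accepting conditions over a set `Q` of states. -/
inductive AccCond (Q : Type u) : Type u
  | inf (S : Set Q) : AccCond Q
  | fin (S : Set Q) : AccCond Q
  | or (a b : AccCond Q) : AccCond Q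
  | and (a b : AccCond Q) : AccCond Q

/-- The set of states that occur infinitely often in a run. -/
def infStates {Q : Type u} (r : ℕ → Q) : Set Q := {q | ∃ᶠ n in Filter.atTop, r n = q}

/-- `r ⊨ α` for accepting conditions. -/
def AccCond.Holds {Q : Type u} (r : ℕ → Q) : AccCond Q → Prop
  | .inf S => infStates r ∩ S ≠ ∅
  | .fin S => infStates r ∩ S = ∅
  | .or a b => a.Holds r ∨ b.Holds r
  | .and a b => a.Holds r ∧ b.Holds r

/-- The disjunction of the members of a nonempty list (the empty disjunction is
the unsatisfiable condition `inf ∅`). -/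
def AccCond.disj {Q : Type u} : List (AccCond Q) → AccCond Q
  | [] => .inf ∅
  | [a] => a
  | a :: b :: l => .or a (AccCond.disj (b :: l))

/-- The disjunction of `inf I ∧ fin F` over the pairs `(I, F)` of the list. -/
def AccCond.rabin {Q : Type u} (l : List (Set Q × Set Q)) : AccCond Q :=
  AccCond.disj (l.map fun p => .and (.inf p.1) (.fin p.2))

/-- A nondeterministic omega-automaton with alphabet `A` and state set `Q`. -/
structure OmegaAutomaton (A : Type u) (Q : Type v) where
  trans : Q → A → Set Q
  init : Set Q
  acc : AccCond Q

namespace OmegaAutomaton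

variable {A : Type u} {Q : Type v}

def IsDeterministic (M : OmegaAutomaton A Q) : Prop :=
  (∃ q, M.init = {q}) ∧ ∀ q a, ∃ q', M.trans q a = {q'}

def IsRun (M : OmegaAutomaton A Q) (w : ℕ → A) (r : ℕ → Q) : Prop :=
  r 0 ∈ M.init ∧ ∀ i, r (i + 1) ∈ M.trans (r i) (w i)

/-- The omega-language recognized by `M`. -/
def language (M : OmegaAutomaton A Q) : Set (ℕ → A) :=
  {w | ∃ r, M.IsRun w r ∧ M.acc.Holds r}

/-- Deterministic Büchi automaton (with finitely many states). -/
def IsDBA (M : OmegaAutomaton A Q) : Prop :=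
  Finite Q ∧ M.IsDeterministic ∧ ∃ S : Set Q, M.acc = .inf S

/-- Deterministic coBüchi automaton (with finitely many states). -/
def IsDCA (M : OmegaAutomaton A Q) : Prop :=
  Finite Q ∧ M.IsDeterministic ∧ ∃ S : Set Q, M.acc = .fin S

/-- Deterministic Rabin automaton (with finitely many states) with `k ≥ 1` Rabin pairs. -/
def IsDRA (M : OmegaAutomaton A Q) (k : ℕ) : Prop :=
  Finite Q ∧ M.IsDeterministic ∧
    ∃ l : List (Set Q × Set Q), 1 ≤ k ∧ l.length = k ∧ M.acc = .rabin l

end OmegaAutomaton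

/-- Transition function and initial state of a deterministic automaton. -/
structure DetPre (A : Type u) (Q : Type v) where
  step : Q → A → Q
  start : Q

namespace DetPre

/-- The deterministic omega-automaton with the given accepting condition. -/
def withAcc {A : Type u} {Q : Type v} (P : DetPre A Q) (α : AccCond Q) : OmegaAutomaton A Q where
  trans q a := {P.step q a}
  init := {P.start}
  acc := α

/-- Product of a family of deterministic pre-automata. -/
def pi {A : Type u} {ι : Type u} {Q : ι → Type v} (P : ∀ i, DetPre A (Q i)) :
    DetPre A (∀ i, Q i) where
  step q a i := (P i).step (q i) a
  start i := (P i).start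

/-- Product of three deterministic pre-automata. -/
def prod3 {A : Type u} {Q₁ Q₂ Q₃ : Type v}
    (P₁ : DetPre A Q₁) (P₂ : DetPre A Q₂) (P₃ : DetPre A Q₃) : DetPre A (Q₁ × Q₂ × Q₃) where
  step q a := (P₁.step q.1 a, P₂.step q.2.1 a, P₃.step q.2.2 a)
  start := (P₁.start, P₂.start, P₃.start)

/-- The component number `c` of the tuple `q` (if there is one) lies in its set `S`. -/
def CounterHit {ι : Type u} {Q : ι → Type v} {k : ℕ} (e : ι ≃ Fin k) (S : ∀ i, Set (Q i))
    (q : ∀ i, Q i) (c : ℕ) : Prop :=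
  ∀ i, (e i : ℕ) = c → q i ∈ S i

/-- The product of `k` deterministic pre-automata together with a cyclic counter that says which
of the sets `S i` is to be visited next. The counter has `k` values if `k ≥ 1` and one value
if `k = 0`; its addition is modulo the number of values. -/
def counterPi {A : Type u} {ι : Type u} {Q : ι → Type v} {k : ℕ} (e : ι ≃ Fin k)
    (P : ∀ i, DetPre A (Q i)) (S : ∀ i, Set (Q i)) :
    DetPre A ((∀ i, Q i) × Fin (k - 1 + 1)) where
  step q a := ((pi P).step q.1 a, if CounterHit e S q.1 q.2 then q.2 + 1 else q.2)
  start := ((pi P).start, 0)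

/-- The accepting states of `counterPi`. -/
def counterAcc {ι : Type u} {Q : ι → Type v} {k : ℕ} (e : ι ≃ Fin k) (S : ∀ i, Set (Q i)) :
    Set ((∀ i, Q i) × Fin (k - 1 + 1)) :=
  {q | q.2 = 0 ∧ CounterHit e S q.1 0}

end DetPre

/-! ## Linear temporal logic -/

/-- LTL formulas in negation normal form over the atomic propositions `Ap`. -/
inductive LTL (Ap : Type u) : Type u
  | tt : LTL Ap
  | ff : LTL Ap
  | atom (a : Ap) : LTL Ap
  | natom (a : Ap) : LTL Ap
  | conj (φ ψ : LTL Ap) : LTL Ap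
  | disj (φ ψ : LTL Ap) : LTL Ap
  | X (φ : LTL Ap) : LTL Ap
  | F (φ : LTL Ap) : LTL Ap
  | G (φ : LTL Ap) : LTL Ap
  | U (φ ψ : LTL Ap) : LTL Ap
  | W (φ ψ : LTL Ap) : LTL Ap
  | M (φ ψ : LTL Ap) : LTL Ap
  | R (φ ψ : LTL Ap) : LTL Ap

namespace LTL

variable {Ap : Type u}

/-- Satisfaction of a formula by an omega-word over the alphabet of sets of atomic propositions. -/
def Sat : (ℕ → Set Ap) → LTL Ap → Prop
  | _, tt => True
  | _, ff => False
  | w, atom a => a ∈ w 0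
  | w, natom a => a ∉ w 0
  | w, conj φ ψ => Sat w φ ∧ Sat w ψ
  | w, disj φ ψ => Sat w φ ∨ Sat w ψ
  | w, X φ => Sat (wordSuffix w 1) φ
  | w, F φ => ∃ k, Sat (wordSuffix w k) φ
  | w, G φ => ∀ k, Sat (wordSuffix w k) φ
  | w, U φ ψ => ∃ k, Sat (wordSuffix w k) ψ ∧ ∀ j < k, Sat (wordSuffix w j) φ
  | w, W φ ψ => (∀ k, Sat (wordSuffix w k) φ) ∨
      ∃ k, Sat (wordSuffix w k) ψ ∧ ∀ j < k, Sat (wordSuffix w j) φ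
  | w, M φ ψ => ∃ k, Sat (wordSuffix w k) φ ∧ ∀ j ≤ k, Sat (wordSuffix w j) ψ
  | w, R φ ψ => (∀ k, Sat (wordSuffix w k) ψ) ∨
      ∃ k, Sat (wordSuffix w k) φ ∧ ∀ j ≤ k, Sat (wordSuffix w j) ψ

/-- The language of a formula. -/
def lang (φ : LTL Ap) : Set (ℕ → Set Ap) := {w | Sat w φ}

/-- The length of a formula: the number of nodes of its syntax tree, whose leaves
are the constants and the literals. -/
def length : LTL Ap → ℕ
  | tt | ff | atom _ | natom _ => 1
  | X φ | F φ | G φ => φ.length + 1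
  | conj φ ψ | disj φ ψ | U φ ψ | W φ ψ | M φ ψ | R φ ψ => φ.length + ψ.length + 1

/-- The set of subformulas. -/
def sf : LTL Ap → Finset (LTL Ap)
  | tt => {tt}
  | ff => {ff}
  | atom a => {atom a}
  | natom a => {natom a}
  | conj φ ψ => insert (conj φ ψ) (φ.sf ∪ ψ.sf)
  | disj φ ψ => insert (disj φ ψ) (φ.sf ∪ ψ.sf)
  | X φ => insert (X φ) φ.sf
  | F φ => insert (F φ) φ.sf
  | G φ => insert (G φ) φ.sf
  | U φ ψ => insert (U φ ψ) (φ.sf ∪ ψ.sf)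
  | W φ ψ => insert (W φ ψ) (φ.sf ∪ ψ.sf)
  | M φ ψ => insert (M φ ψ) (φ.sf ∪ ψ.sf)
  | R φ ψ => insert (R φ ψ) (φ.sf ∪ ψ.sf)

/-- The root is a least-fixed-point operator. -/
def IsMu : LTL Ap → Prop
  | F _ | U _ _ | M _ _ => True
  | _ => False

/-- The root is a greatest-fixed-point operator. -/
def IsNu : LTL Ap → Prop
  | G _ | W _ _ | R _ _ => True
  | _ => False

/-- The subformulas of the forms `F ψ`, `ψ₁ U ψ₂`, `ψ₁ M ψ₂`. -/
def mu (φ : LTL Ap) : Finset (LTL Ap) := φ.sf.filter IsMu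

/-- The subformulas of the forms `G ψ`, `ψ₁ W ψ₂`, `ψ₁ R ψ₂`. -/
def nu (φ : LTL Ap) : Finset (LTL Ap) := φ.sf.filter IsNu

/-! ### Propositional equivalence -/

/-- The truth value of the propositional formula obtained from a formula by replacing every
maximal proper subformula `ψ` by a propositional variable, under the assignment
that gives this variable the value `v ψ`. -/
def evalP (v : LTL Ap → Prop) : LTL Ap → Prop
  | tt => True
  | ff => False
  | conj φ ψ => evalP v φ ∧ evalP v ψ
  | disj φ ψ => evalP v φ ∨ evalP v ψ
  | φ => v φ

/-- Propositional equivalence. -/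
def PropEquiv (φ ψ : LTL Ap) : Prop := ∀ v : LTL Ap → Prop, evalP v φ ↔ evalP v ψ

instance propSetoid (Ap : Type u) : Setoid (LTL Ap) where
  r := PropEquiv
  iseqv := ⟨fun _ _ => Iff.rfl, fun h v => (h v).symm, fun h h' v => (h v).trans (h' v)⟩

/-- Classes of formulas modulo propositional equivalence. -/
abbrev PropClass (Ap : Type u) : Type u := Quotient (propSetoid Ap)

/-- The class of a formula modulo propositional equivalence. -/
def cls (φ : LTL Ap) : PropClass Ap := Quotient.mk _ φ

/-! ### The "after" function -/

/-- The formula `φ` after the letter `ν`. -/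
def af : LTL Ap → Set Ap → LTL Ap
  | tt, _ => tt
  | ff, _ => ff
  | atom a, ν => if a ∈ ν then tt else ff
  | natom a, ν => if a ∈ ν then ff else tt
  | conj φ ψ, ν => conj (af φ ν) (af ψ ν)
  | disj φ ψ, ν => disj (af φ ν) (af ψ ν)
  | X φ, _ => φ
  | F φ, ν => disj (af φ ν) (F φ)
  | G φ, ν => conj (af φ ν) (G φ)
  | U φ ψ, ν => disj (af ψ ν) (conj (af φ ν) (U φ ψ))
  | W φ ψ, ν => disj (af ψ ν) (conj (af φ ν) (W φ ψ))
  | M φ ψ, ν => conj (af ψ ν) (disj (af φ ν) (M φ ψ))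
  | R φ ψ, ν => conj (af ψ ν) (disj (af φ ν) (R φ ψ))

/-- The formula `φ` after the finite word `w`. -/
def afWord (φ : LTL Ap) (w : List (Set Ap)) : LTL Ap := w.foldl af φ

/-- The classes of the formulas reachable from `φ`. -/
def Reach (φ : LTL Ap) : Set (PropClass Ap) := {c | ∃ w : List (Set Ap), c = cls (afWord φ w)}

/-! ### Formulas with advice -/

/-- The formula `φ` with GF-advice `S`, usually written `φ[S]_ν`. -/
def evalNu (S : Finset (LTL Ap)) : LTL Ap → LTL Ap
  | tt => tt
  | ff => ff
  | atom a => atom a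
  | natom a => natom a
  | conj φ ψ => conj (evalNu S φ) (evalNu S ψ)
  | disj φ ψ => disj (evalNu S φ) (evalNu S ψ)
  | X φ => X (evalNu S φ)
  | G φ => G (evalNu S φ)
  | W φ ψ => W (evalNu S φ) (evalNu S ψ)
  | R φ ψ => R (evalNu S φ) (evalNu S ψ)
  | F φ => if F φ ∈ S then tt else ff
  | U φ ψ => if U φ ψ ∈ S then W (evalNu S φ) (evalNu S ψ) else ff
  | M φ ψ => if M φ ψ ∈ S then R (evalNu S φ) (evalNu S ψ) else ff

/-- The formula `φ` with FG-advice `T`, usually written `φ[T]_μ`. -/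
def evalMu (T : Finset (LTL Ap)) : LTL Ap → LTL Ap
  | tt => tt
  | ff => ff
  | atom a => atom a
  | natom a => natom a
  | conj φ ψ => conj (evalMu T φ) (evalMu T ψ)
  | disj φ ψ => disj (evalMu T φ) (evalMu T ψ)
  | X φ => X (evalMu T φ)
  | F φ => F (evalMu T φ)
  | U φ ψ => U (evalMu T φ) (evalMu T ψ)
  | M φ ψ => M (evalMu T φ) (evalMu T ψ)
  | G φ => if G φ ∈ T then tt else ff
  | W φ ψ => if W φ ψ ∈ T then tt else U (evalMu T φ) (evalMu T ψ)
  | R φ ψ => if R φ ψ ∈ T then tt else M (evalMu T φ) (evalMu T ψ)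

/-! ### The operations on classes -/

theorem evalP_af (v : LTL Ap → Prop) (ν : Set Ap) (φ : LTL Ap) :
    evalP v (af φ ν) ↔ evalP (fun ψ => evalP v (af ψ ν)) φ := by
  induction φ <;> simp_all [af, evalP]

theorem evalP_evalNu (v : LTL Ap → Prop) (S : Finset (LTL Ap)) (φ : LTL Ap) :
    evalP v (evalNu S φ) ↔ evalP (fun ψ => evalP v (evalNu S ψ)) φ := by
  induction φ <;> simp_all [evalNu, evalP]

/-- The "after" function on classes. -/
def afCls (c : PropClass Ap) (ν : Set Ap) : PropClass Ap :=
  Quotient.map (fun φ => af φ ν)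
    (fun φ ψ h v => (evalP_af v ν φ).trans ((h _).trans (evalP_af v ν ψ).symm)) c

/-- GF-advice on classes. -/
def evalNuCls (S : Finset (LTL Ap)) (c : PropClass Ap) : PropClass Ap :=
  Quotient.map (evalNu S)
    (fun φ ψ h v => (evalP_evalNu v S φ).trans ((h _).trans (evalP_evalNu v S ψ).symm)) c

theorem cls_mem_reach (φ : LTL Ap) : cls φ ∈ Reach φ := ⟨[], rfl⟩

theorem afCls_mem_reach {φ : LTL Ap} {c : PropClass Ap} (hc : c ∈ Reach φ) (ν : Set Ap) :
    afCls c ν ∈ Reach φ := by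
  obtain ⟨w, rfl⟩ := hc
  exact ⟨w ++ [ν], by unfold afWord; rw [List.foldl_append]; rfl⟩

/-- The union of the sets `Reach (ψ[S]_ν)` over the formulas `ψ` whose class is
reachable from `φ`. -/
def ReachNu (S : Finset (LTL Ap)) (φ : LTL Ap) : Set (PropClass Ap) :=
  {c | ∃ ψ : LTL Ap, cls ψ ∈ Reach φ ∧ c ∈ Reach (evalNu S ψ)}

theorem cls_mem_reachNu (S : Finset (LTL Ap)) (φ : LTL Ap) : cls (evalNu S φ) ∈ ReachNu S φ :=
  ⟨φ, cls_mem_reach φ, cls_mem_reach _⟩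

theorem afCls_mem_reachNu {S : Finset (LTL Ap)} {φ : LTL Ap} {c : PropClass Ap}
    (hc : c ∈ ReachNu S φ) (ν : Set Ap) : afCls c ν ∈ ReachNu S φ := by
  obtain ⟨ψ, hψ, h⟩ := hc
  exact ⟨ψ, hψ, afCls_mem_reach h ν⟩

theorem afCls_evalNuCls_mem_reachNu {S : Finset (LTL Ap)} {φ : LTL Ap} {c : PropClass Ap}
    (hc : c ∈ Reach φ) (ν : Set Ap) : afCls (evalNuCls S c) ν ∈ ReachNu S φ := by
  induction c using Quotient.inductionOn with
  | h ψ => exact ⟨ψ, hc, afCls_mem_reach (cls_mem_reach _) ν⟩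

/-! ### Automata for the fragments `GF(μLTL)` and `FG(νLTL)` -/

/-- States and transitions of the automaton for `G F φ`, where `φ` is in `μLTL`: the state is the
class of the formula still to be checked, and after the state `tt` the check of `F φ` restarts. -/
def gfPre (φ : LTL Ap) : DetPre (Set Ap) (Reach (F φ)) where
  step c ν := if c.1 = cls tt then ⟨cls (F φ), cls_mem_reach _⟩
    else ⟨afCls c.1 ν, afCls_mem_reach c.2 ν⟩
  start := ⟨cls (F φ), cls_mem_reach _⟩

/-- The set `{tt}` of accepting states of the automaton for `G F φ`. -/
def gfAcc (φ : LTL Ap) : Set (Reach (F φ)) := {c | c.1 = cls tt}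

/-- States and transitions of the automaton for `F G φ`, where `φ` is in `νLTL`: the state is the
class of the formula still to be checked, and after the state `ff` the check of `G φ` restarts. -/
def fgPre (φ : LTL Ap) : DetPre (Set Ap) (Reach (G φ)) where
  step c ν := if c.1 = cls ff then ⟨cls (G φ), cls_mem_reach _⟩
    else ⟨afCls c.1 ν, afCls_mem_reach c.2 ν⟩
  start := ⟨cls (G φ), cls_mem_reach _⟩

/-- The set `{ff}` of rejecting states of the automaton for `F G φ`. -/
def fgRej (φ : LTL Ap) : Set (Reach (G φ)) := {c | c.1 = cls ff}

/-! ### The three languages of the decomposition and their automata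

Here `S` is a set of subformulas in `mu φ` and `T` is a set of subformulas in `nu φ`. -/

/-- Some suffix `w_i` satisfies `af(φ, w_{0i})[S]_ν`. -/
def L1 (φ : LTL Ap) (S : Finset (LTL Ap)) : Set (ℕ → Set Ap) :=
  {w | ∃ i, Sat (wordSuffix w i) (evalNu S (afWord φ (wordPrefix w i)))}

/-- `w` satisfies `G F (ψ[T]_μ)` for every `ψ ∈ S`. -/
def L2 (S T : Finset (LTL Ap)) : Set (ℕ → Set Ap) :=
  {w | ∀ ψ ∈ S, Sat w (G (F (evalMu T ψ)))}

/-- `w` satisfies `F G (ψ[S]_ν)` for every `ψ ∈ T`. -/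
def L3 (S T : Finset (LTL Ap)) : Set (ℕ → Set Ap) :=
  {w | ∀ ψ ∈ T, Sat w (F (G (evalNu S ψ)))}

/-- State set of the formula/advice-switching automaton. -/
abbrev St1 (φ : LTL Ap) (S : Finset (LTL Ap)) : Type u := Reach φ × ReachNu S φ

/-- Transitions of the formula/advice-switching automaton. -/
def pre1 (φ : LTL Ap) (S : Finset (LTL Ap)) : DetPre (Set Ap) (St1 φ S) where
  step q ν := (⟨afCls q.1.1 ν, afCls_mem_reach q.1.2 ν⟩,
    if q.2.1 = cls ff then ⟨afCls (evalNuCls S q.1.1) ν, afCls_evalNuCls_mem_reachNu q.1.2 ν⟩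
    else ⟨afCls q.2.1 ν, afCls_mem_reachNu q.2.2 ν⟩)
  start := (⟨cls φ, cls_mem_reach φ⟩, ⟨cls (evalNu S φ), cls_mem_reachNu S φ⟩)

/-- The states of the formula/advice-switching automaton with second component `ff`. -/
def rej1 (φ : LTL Ap) (S : Finset (LTL Ap)) : Set (St1 φ S) := {q | q.2.1 = cls ff}

/-- The formula/advice-switching automaton. -/
def aut1 (φ : LTL Ap) (S : Finset (LTL Ap)) : OmegaAutomaton (Set Ap) (St1 φ S) :=
  (pre1 φ S).withAcc (.fin (rej1 φ S))

/-- State set of the Büchi automaton for `L2`. -/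
abbrev St2 (S T : Finset (LTL Ap)) : Type u :=
  (∀ ψ : S, Reach (F (evalMu T ψ.1))) × Fin (S.card - 1 + 1)

/-- Transitions of the Büchi automaton for `L2`: intersection of the automata for the formulas
`G F (ψ[T]_μ)`, `ψ ∈ S`. -/
def pre2 (S T : Finset (LTL Ap)) : DetPre (Set Ap) (St2 S T) :=
  DetPre.counterPi S.equivFin (fun ψ => gfPre (evalMu T ψ.1)) (fun ψ => gfAcc (evalMu T ψ.1))

/-- Accepting states of the Büchi automaton for `L2`. -/
def acc2 (S T : Finset (LTL Ap)) : Set (St2 S T) :=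
  DetPre.counterAcc S.equivFin (fun ψ => gfAcc (evalMu T ψ.1))

/-- The Büchi automaton for `L2`. -/
def aut2 (S T : Finset (LTL Ap)) : OmegaAutomaton (Set Ap) (St2 S T) :=
  (pre2 S T).withAcc (.inf (acc2 S T))

/-- State set of the coBüchi automaton for `L3`. -/
abbrev St3 (S T : Finset (LTL Ap)) : Type u := ∀ ψ : T, Reach (G (evalNu S ψ.1))

/-- Transitions of the coBüchi automaton for `L3`: product of the automata for the formulas
`F G (ψ[S]_ν)`, `ψ ∈ T`. -/
def pre3 (S T : Finset (LTL Ap)) : DetPre (Set Ap) (St3 S T) :=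
  DetPre.pi (fun ψ : T => fgPre (evalNu S ψ.1))

/-- Rejecting states of the coBüchi automaton for `L3`: some component is rejecting. -/
def rej3 (S T : Finset (LTL Ap)) : Set (St3 S T) := {q | ∃ ψ, q ψ ∈ fgRej (evalNu S ψ.1)}

/-- The coBüchi automaton for `L3`. -/
def aut3 (S T : Finset (LTL Ap)) : OmegaAutomaton (Set Ap) (St3 S T) :=
  (pre3 S T).withAcc (.fin (rej3 S T))

/-! ### The Rabin automata -/

/-- State set of the product of the three automata. -/
abbrev StPair (φ : LTL Ap) (S T : Finset (LTL Ap)) : Type u := St1 φ S × St2 S T × St3 S T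

/-- Transitions of the product of the three automata. -/
def prePair (φ : LTL Ap) (S T : Finset (LTL Ap)) : DetPre (Set Ap) (StPair φ S T) :=
  DetPre.prod3 (pre1 φ S) (pre2 S T) (pre3 S T)

/-- The single Rabin pair of the product of the three automata: a set to be visited
infinitely often and a set to be visited finitely often. -/
def rabinPair (φ : LTL Ap) (S T : Finset (LTL Ap)) : Set (StPair φ S T) × Set (StPair φ S T) :=
  ({q | q.2.1 ∈ acc2 S T}, {q | q.1 ∈ rej1 φ S} ∪ {q | q.2.2 ∈ rej3 S T})

/-- The Rabin automaton for the intersection of `L1`, `L2` and `L3`. -/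
def autPair (φ : LTL Ap) (S T : Finset (LTL Ap)) : OmegaAutomaton (Set Ap) (StPair φ S T) :=
  (prePair φ S T).withAcc (.rabin [rabinPair φ S T])

/-- The pairs `(S, T)` with `S ⊆ mu φ` and `T ⊆ nu φ`. -/
def advice (φ : LTL Ap) : Finset (Finset (LTL Ap) × Finset (LTL Ap)) :=
  φ.mu.powerset ×ˢ φ.nu.powerset

/-- State set of the Rabin automaton for `φ`. -/
abbrev StDRA (φ : LTL Ap) : Type u := ∀ p : advice φ, StPair φ p.1.1 p.1.2

/-- The Rabin automaton for `φ`: the product of the automata for all pairs `(S, T)`, with one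
Rabin pair for each of them. -/
def dra (φ : LTL Ap) : OmegaAutomaton (Set Ap) (StDRA φ) :=
  (DetPre.pi (fun p : advice φ => prePair φ p.1.1 p.1.2)).withAcc
    (.rabin ((advice φ).attach.toList.map fun p =>
      ({q | q p ∈ (rabinPair φ p.1.1 p.1.2).1}, {q | q p ∈ (rabinPair φ p.1.1 p.1.2).2})))

end LTL

end

/-!
A run of a deterministic automaton on a word is unique (`DetPre.run`), and the accepting conditions
speak about states visited infinitely often or only finitely often along it.

The formula `af φ u` describes what remains to be checked of `φ` after the prefix `u`. A formula
without least-fixed-point operators is violated only by a finite prefix, which turns it into a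
propositional contradiction (`LTL.eventually_not_evalAfter`), and dually for formulas without
greatest-fixed-point operators (`LTL.eventually_evalAfter`). Therefore a monitor that computes `af`
and restarts whenever it has found a violation recognizes whether, from some position on, there is
nothing left to violate (`LTL.eventually_ne_ff_iff`); this one fact covers both coBüchi automata.
For `L1` it applies because advice stays correct once it is correct (`LTL.sat_evalNu_af`). The Büchi
automata are dual (`LTL.frequently_mem_gfAcc_iff`), and the cyclic counter intersects them
(`DetPre.frequently_counter_iff`).

That `L1 ∩ L2 ∩ L3`, taken over all advice `(S, T)`, covers exactly the models of `φ` rests on four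
implications between a formula and the formula with advice. If `w` satisfies `φ`, the true advice
(which subformulas hold infinitely often, and which from some point on) puts `w` in the three
languages (`LTL.exists_mem_L`). Conversely, advice that passes the checks of `L2` and `L3` is true
by induction on the length of the formulas in it (`LTL.sat_GF_and_sat_FG_of_mem`), and with
true advice the condition `L1` gives back `φ` (`LTL.sat_of_mem_L`).

For the number of states, everything reachable from `φ` is a positive Boolean combination of
subformulas of `φ` (with advice), of which there are at most `n`. So a class is determined by a set
of assignments to `n` variables, and there are at most `2 ^ 2 ^ n` of them
(`LTL.finite_and_card_le`). The products multiply the exponent `2 ^ n` by single exponentials at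
most, which the constant `7` absorbs.
-/

section

open scoped Classical
open Filter

/-! ### Runs of deterministic automata -/

namespace AccCond

theorem holds_inf_iff {Q : Type v} [Finite Q] (r : ℕ → Q) (S : Set Q) :
    (AccCond.inf S).Holds r ↔ ∃ᶠ n in atTop, r n ∈ S := by
  constructor
  · intro h
    obtain ⟨q, hq, hS⟩ := Set.nonempty_iff_ne_empty.2 h
    exact Frequently.mono hq fun n hn => hn ▸ hS
  · intro h
    refine Set.nonempty_iff_ne_empty.1 ?_
    -- one of the finitely many states of `S` is visited infinitely often
    have h' : ∃ᶠ n in atTop, ∃ q, r n = q ∧ q ∈ S := h.mono fun n hn => ⟨_, rfl, hn⟩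
    obtain ⟨q, hq⟩ := frequently_exists.1 h'
    exact ⟨q, hq.mono fun n hn => hn.1, hq.exists.choose_spec.2⟩

theorem holds_fin_iff {Q : Type v} [Finite Q] (r : ℕ → Q) (S : Set Q) :
    (AccCond.fin S).Holds r ↔ ∀ᶠ n in atTop, r n ∉ S := by
  have h := holds_inf_iff r S
  rw [← not_iff_not, not_eventually]
  simpa [AccCond.Holds] using h

theorem holds_disj_iff {Q : Type v} (r : ℕ → Q) (l : List (AccCond Q)) :
    (AccCond.disj l).Holds r ↔ ∃ a ∈ l, a.Holds r := by
  induction l with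
  | nil => simp [AccCond.disj, AccCond.Holds]
  | cons a l ih =>
    cases l with
    | nil => simp [AccCond.disj]
    | cons b l => rw [AccCond.disj, AccCond.Holds, ih]; simp

theorem holds_rabin_iff {Q : Type v} [Finite Q] (r : ℕ → Q) (l : List (Set Q × Set Q)) :
    (AccCond.rabin l).Holds r ↔
      ∃ p ∈ l, (∃ᶠ n in atTop, r n ∈ p.1) ∧ ∀ᶠ n in atTop, r n ∉ p.2 := by
  rw [AccCond.rabin, holds_disj_iff]
  simp only [List.mem_map, exists_exists_and_eq_and]
  simp only [AccCond.Holds.eq_4, holds_inf_iff, holds_fin_iff]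

end AccCond

namespace DetPre

variable {A : Type u} {Q : Type v}

/-- The state reached after `n` letters of the word `w`. -/
def run (P : DetPre A Q) (w : ℕ → A) : ℕ → Q
  | 0 => P.start
  | n + 1 => P.step (run P w n) (w n)

theorem mem_language_withAcc (P : DetPre A Q) (α : AccCond Q) (w : ℕ → A) :
    w ∈ (P.withAcc α).language ↔ α.Holds (P.run w) := by
  constructor
  · rintro ⟨r, ⟨h0, hs⟩, hα⟩
    have : r = P.run w := by
      funext n
      induction n with
      | zero => exact h0
      | succ n ih => exact (hs n).trans (by rw [ih]; rfl)
    exact this ▸ hα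
  · exact fun h => ⟨P.run w, ⟨rfl, fun _ => rfl⟩, h⟩

theorem isDeterministic_withAcc (P : DetPre A Q) (α : AccCond Q) :
    (P.withAcc α).IsDeterministic :=
  ⟨⟨_, rfl⟩, fun _ _ => ⟨_, rfl⟩⟩

theorem run_pi {ι : Type u} {Q : ι → Type v} (P : ∀ i, DetPre A (Q i)) (w : ℕ → A) (n : ℕ)
    (i : ι) : (pi P).run w n i = (P i).run w n := by
  induction n with
  | zero => rfl
  | succ n ih => simp only [run, pi] at ih ⊢; rw [ih]

theorem run_prod3 {Q₁ Q₂ Q₃ : Type v}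
    (P₁ : DetPre A Q₁) (P₂ : DetPre A Q₂) (P₃ : DetPre A Q₃) (w : ℕ → A) (n : ℕ) :
    (prod3 P₁ P₂ P₃).run w n = (P₁.run w n, P₂.run w n, P₃.run w n) := by
  induction n with
  | zero => rfl
  | succ n ih => simp only [run, ih]; rfl

theorem run_counterPi_fst {ι : Type u} {Q : ι → Type v} {k : ℕ} (e : ι ≃ Fin k)
    (P : ∀ i, DetPre A (Q i)) (S : ∀ i, Set (Q i)) (w : ℕ → A) (n : ℕ) :
    ((counterPi e P S).run w n).1 = fun i => (P i).run w n := by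
  induction n with
  | zero => rfl
  | succ n ih => funext i; simp only [run, counterPi, pi] at ih ⊢; rw [ih]

/-- A cyclic counter that waits in the value `x` for the event `H · x` passes the value `0`
infinitely often exactly when each of these events occurs infinitely often. -/
theorem frequently_counter_iff {m : ℕ} (c : ℕ → Fin (m + 1)) (H : ℕ → Fin (m + 1) → Prop)
    (hc : ∀ n, c (n + 1) = if H n (c n) then c n + 1 else c n) :
    (∃ᶠ n in atTop, c n = 0 ∧ H n 0) ↔ ∀ x, ∃ᶠ n in atTop, H n x := by
  have stay : ∀ x N, c N = x → (∀ n, N ≤ n → ¬ (c n = x ∧ H n x)) → ∀ n, N ≤ n → c n = x := by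
    intro x N hN h n hn
    induction n, hn using Nat.le_induction with
    | base => exact hN
    | succ n hn ih =>
      have := h n hn
      rw [hc, ih, if_neg (fun hH => this ⟨ih, hH⟩)]
  have next : ∀ x, (∃ᶠ n in atTop, c n = x ∧ H n x) → ∃ᶠ n in atTop, c n = x + 1 := by
    intro x h
    rw [frequently_atTop] at h ⊢
    intro a
    obtain ⟨n, hn, h1, h2⟩ := h a
    exact ⟨n + 1, by omega, by rw [hc, h1, if_pos h2]⟩
  constructor
  · intro h0
    suffices ∀ x, ∃ᶠ n in atTop, c n = x ∧ H n x from fun x => (this x).mono fun n hn => hn.2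
    intro x
    induction x using Fin.induction with
    | zero => exact h0
    | succ i ih =>
      have h1 := next _ ih
      rw [Fin.coeSucc_eq_succ] at h1
      -- a counter stuck in a nonzero value would not return to `0`
      by_contra hcon
      obtain ⟨N, hN⟩ := eventually_atTop.1 (not_frequently.1 hcon)
      obtain ⟨M, hM, hM'⟩ := frequently_atTop.1 h1 N
      obtain ⟨n, hn, hn', -⟩ := frequently_atTop.1 h0 M
      have := stay _ M hM' (fun n hn => hN n (hM.trans hn)) n hn
      exact Fin.succ_ne_zero i (this.symm.trans hn')
  · intro h
    have wait : ∀ x, (∃ᶠ n in atTop, c n = x) → ∃ᶠ n in atTop, c n = x ∧ H n x := by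
      intro x hx
      by_contra hcon
      obtain ⟨N, hN⟩ := eventually_atTop.1 (not_frequently.1 hcon)
      obtain ⟨M, hM, hM'⟩ := frequently_atTop.1 hx N
      obtain ⟨n, hn, hn'⟩ := frequently_atTop.1 (h x) M
      have := stay _ M hM' (fun n hn => hN n (hM.trans hn)) n hn
      exact hN n (hM.trans hn) ⟨this, hn'⟩
    -- some value occurs infinitely often, and from it the counter advances to `0`
    obtain ⟨x, hx⟩ : ∃ x, ∃ᶠ n in atTop, c n = x :=
      frequently_exists.1 (Eventually.frequently (Eventually.of_forall fun n => ⟨c n, rfl⟩))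
    refine wait 0 ?_
    induction x using Fin.reverseInduction with
    | last => simpa using next _ (wait _ hx)
    | cast i ih => exact ih (by simpa using next _ (wait _ hx))

theorem frequently_counterAcc_iff {ι : Type u} {Q : ι → Type v} {k : ℕ} (e : ι ≃ Fin k)
    (P : ∀ i, DetPre A (Q i)) (S : ∀ i, Set (Q i)) (w : ℕ → A) :
    (∃ᶠ n in atTop, (counterPi e P S).run w n ∈ counterAcc e S) ↔
      ∀ i, ∃ᶠ n in atTop, (P i).run w n ∈ S i := by
  have key := frequently_counter_iff (fun n => ((counterPi e P S).run w n).2)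
    (fun n x => CounterHit e S (fun i => (P i).run w n) x) (fun n => by
      rw [← run_counterPi_fst e P S w n]; rfl)
  have h1 : (∃ᶠ n in atTop, (counterPi e P S).run w n ∈ counterAcc e S) ↔
      ∃ᶠ n in atTop, ((counterPi e P S).run w n).2 = 0 ∧
        CounterHit e S (fun i => (P i).run w n) (0 : Fin (k - 1 + 1)) := by
    refine frequently_congr (Eventually.of_forall fun n => ?_)
    rw [← run_counterPi_fst e P S w n]; rfl
  rw [h1, key]
  constructor
  · intro h i
    have hi := (e i).2
    exact (h ⟨e i, by omega⟩).mono fun n hn => hn i rfl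
  · intro h x
    by_cases hx : ∃ i, (e i : ℕ) = x
    · obtain ⟨i, hi⟩ := hx
      refine (h i).mono fun n hn j hj => ?_
      have : j = i := e.injective (Fin.ext (hj.trans hi.symm))
      exact this ▸ hn
    · -- this happens for the empty family only, whose counter has the single value `0`
      exact Eventually.frequently (Eventually.of_forall fun n j hj => (hx ⟨j, hj⟩).elim)

end DetPre

/-! ### Words, satisfaction and the "after" function -/

@[simp]
theorem wordSuffix_zero {A : Type u} (w : ℕ → A) : wordSuffix w 0 = w := by
  funext k; simp [wordSuffix]

@[simp]
theorem wordSuffix_wordSuffix {A : Type u} (w : ℕ → A) (i j : ℕ) :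
    wordSuffix (wordSuffix w i) j = wordSuffix w (i + j) := by
  funext k; simp [wordSuffix, add_assoc]

@[simp]
theorem wordPrefix_zero {A : Type u} (w : ℕ → A) : wordPrefix w 0 = [] := rfl

theorem wordPrefix_succ {A : Type u} (w : ℕ → A) (i : ℕ) :
    wordPrefix w (i + 1) = wordPrefix w i ++ [w i] := by
  simp [wordPrefix, List.range_succ]

theorem wordPrefix_succ' {A : Type u} (w : ℕ → A) (i : ℕ) :
    wordPrefix w (i + 1) = w 0 :: wordPrefix (wordSuffix w 1) i := by
  simp only [wordPrefix, List.range_succ_eq_map, List.map_cons, List.map_map]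
  congr 1
  refine List.map_congr_left fun k _ => ?_
  simp [wordSuffix, add_comm]

namespace LTL

variable {Ap : Type u}

theorem afWord_wordPrefix_succ (φ : LTL Ap) (w : ℕ → Set Ap) (i : ℕ) :
    afWord φ (wordPrefix w (i + 1)) = af (afWord φ (wordPrefix w i)) (w i) := by
  rw [wordPrefix_succ, afWord, List.foldl_append]; rfl

theorem exists_until_iff (P Q : ℕ → Prop) :
    (∃ k, P k ∧ ∀ j < k, Q j) ↔ P 0 ∨ (Q 0 ∧ ∃ k, P (k + 1) ∧ ∀ j < k, Q (j + 1)) := by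
  constructor
  · rintro ⟨_ | k, h, h'⟩
    · exact .inl h
    · exact .inr ⟨h' 0 (by omega), k, h, fun j hj => h' _ (by omega)⟩
  · rintro (h | ⟨h, k, h1, h2⟩)
    · exact ⟨0, h, by simp⟩
    · exact ⟨k + 1, h1, fun j hj => by cases j with
        | zero => exact h
        | succ j => exact h2 j (by omega)⟩

theorem exists_release_iff (P Q : ℕ → Prop) :
    (∃ k, P k ∧ ∀ j ≤ k, Q j) ↔ Q 0 ∧ (P 0 ∨ ∃ k, P (k + 1) ∧ ∀ j ≤ k, Q (j + 1)) := by
  constructor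
  · rintro ⟨_ | k, h, h'⟩
    · exact ⟨h' 0 le_rfl, .inl h⟩
    · exact ⟨h' 0 (by omega), .inr ⟨k, h, fun j hj => h' _ (by omega)⟩⟩
  · rintro ⟨h0, h | ⟨k, h1, h2⟩⟩
    · exact ⟨0, h, fun j hj => by obtain rfl : j = 0 := by omega
                                  exact h0⟩
    · exact ⟨k + 1, h1, fun j hj => by cases j with
        | zero => exact h0
        | succ j => exact h2 j (by omega)⟩

theorem forall_nat_iff (P : ℕ → Prop) : (∀ k, P k) ↔ P 0 ∧ ∀ k, P (k + 1) :=
  ⟨fun h => ⟨h 0, fun k => h _⟩, fun h k => by cases k with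
    | zero => exact h.1
    | succ k => exact h.2 k⟩

theorem exists_nat_iff (P : ℕ → Prop) : (∃ k, P k) ↔ P 0 ∨ ∃ k, P (k + 1) :=
  ⟨fun ⟨k, h⟩ => by cases k with
    | zero => exact .inl h
    | succ k => exact .inr ⟨k, h⟩,
  fun h => h.elim (fun h => ⟨0, h⟩) fun ⟨k, h⟩ => ⟨k + 1, h⟩⟩

theorem sat_F_iff (w : ℕ → Set Ap) (φ : LTL Ap) :
    Sat w (F φ) ↔ Sat w φ ∨ Sat (wordSuffix w 1) (F φ) := by
  simp only [Sat]
  rw [exists_nat_iff]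
  simp [add_comm]

theorem sat_G_iff (w : ℕ → Set Ap) (φ : LTL Ap) :
    Sat w (G φ) ↔ Sat w φ ∧ Sat (wordSuffix w 1) (G φ) := by
  simp only [Sat]
  rw [forall_nat_iff]
  simp [add_comm]

theorem sat_U_iff (w : ℕ → Set Ap) (φ ψ : LTL Ap) :
    Sat w (U φ ψ) ↔ Sat w ψ ∨ (Sat w φ ∧ Sat (wordSuffix w 1) (U φ ψ)) := by
  simp only [Sat]
  rw [exists_until_iff]
  simp [add_comm]

theorem sat_M_iff (w : ℕ → Set Ap) (φ ψ : LTL Ap) :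
    Sat w (M φ ψ) ↔ Sat w ψ ∧ (Sat w φ ∨ Sat (wordSuffix w 1) (M φ ψ)) := by
  simp only [Sat]
  rw [exists_release_iff]
  simp [add_comm]

theorem sat_W_iff_U (w : ℕ → Set Ap) (φ ψ : LTL Ap) :
    Sat w (W φ ψ) ↔ Sat w (G φ) ∨ Sat w (U φ ψ) := by simp only [Sat]

theorem sat_R_iff_M (w : ℕ → Set Ap) (φ ψ : LTL Ap) :
    Sat w (R φ ψ) ↔ Sat w (G ψ) ∨ Sat w (M φ ψ) := by simp only [Sat]

theorem sat_W_iff (w : ℕ → Set Ap) (φ ψ : LTL Ap) :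
    Sat w (W φ ψ) ↔ Sat w ψ ∨ (Sat w φ ∧ Sat (wordSuffix w 1) (W φ ψ)) := by
  rw [sat_W_iff_U, sat_W_iff_U, sat_G_iff, sat_U_iff]; tauto

theorem sat_R_iff (w : ℕ → Set Ap) (φ ψ : LTL Ap) :
    Sat w (R φ ψ) ↔ Sat w ψ ∧ (Sat w φ ∨ Sat (wordSuffix w 1) (R φ ψ)) := by
  rw [sat_R_iff_M, sat_R_iff_M, sat_G_iff, sat_M_iff]; tauto

theorem sat_af_iff (w : ℕ → Set Ap) (φ : LTL Ap) :
    Sat (wordSuffix w 1) (af φ (w 0)) ↔ Sat w φ := by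
  induction φ with
  | tt | ff => simp [af, Sat]
  | atom a => by_cases h : a ∈ w 0 <;> simp [af, Sat, h]
  | natom a => by_cases h : a ∈ w 0 <;> simp [af, Sat, h]
  | conj φ ψ h1 h2 => simp [af, Sat, h1, h2]
  | disj φ ψ h1 h2 => simp [af, Sat, h1, h2]
  | X φ h => simp [af, Sat]
  | F φ h => rw [sat_F_iff w, af, Sat, h]
  | G φ h => rw [sat_G_iff w, af, Sat, h]
  | U φ ψ h1 h2 => rw [sat_U_iff w, af, Sat, Sat, h1, h2]
  | W φ ψ h1 h2 => rw [sat_W_iff w, af, Sat, Sat, h1, h2]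
  | M φ ψ h1 h2 => rw [sat_M_iff w, af, Sat, Sat, h1, h2]
  | R φ ψ h1 h2 => rw [sat_R_iff w, af, Sat, Sat, h1, h2]

theorem sat_afWord_iff (w : ℕ → Set Ap) (φ : LTL Ap) (i : ℕ) :
    Sat (wordSuffix w i) (afWord φ (wordPrefix w i)) ↔ Sat w φ := by
  induction i with
  | zero => simp [afWord]
  | succ i ih =>
    rw [← ih, afWord_wordPrefix_succ, ← sat_af_iff (wordSuffix w i), wordSuffix_wordSuffix]
    rfl

/-- Satisfaction is itself a propositional assignment; hence it respects propositional
equivalence. -/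
theorem evalP_sat_iff (w : ℕ → Set Ap) (φ : LTL Ap) : evalP (Sat w) φ ↔ Sat w φ := by
  induction φ <;> simp_all [evalP, Sat]

theorem cls_eq_cls_iff {φ ψ : LTL Ap} : cls φ = cls ψ ↔ ∀ v, evalP v φ ↔ evalP v ψ :=
  Quotient.eq

theorem cls_eq_tt_iff {φ : LTL Ap} : cls φ = cls tt ↔ ∀ v, evalP v φ := by
  simp [cls_eq_cls_iff, evalP]

theorem cls_eq_ff_iff {φ : LTL Ap} : cls φ = cls ff ↔ ∀ v, ¬ evalP v φ := by
  simp [cls_eq_cls_iff, evalP]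

theorem sat_of_cls_eq_tt {φ : LTL Ap} (h : cls φ = cls tt) (w : ℕ → Set Ap) : Sat w φ :=
  (evalP_sat_iff w φ).1 (cls_eq_tt_iff.1 h _)

theorem not_sat_of_cls_eq_ff {φ : LTL Ap} (h : cls φ = cls ff) (w : ℕ → Set Ap) : ¬ Sat w φ :=
  fun hs => cls_eq_ff_iff.1 h _ ((evalP_sat_iff w φ).2 hs)

/-! ### Least- and greatest-fixed-point fragments -/

/-- The fragment without least-fixed-point operators, whose formulas express safety properties. -/
def IsNuLTL : LTL Ap → Prop
  | tt | ff | atom _ | natom _ => True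
  | conj φ ψ | disj φ ψ | W φ ψ | R φ ψ => IsNuLTL φ ∧ IsNuLTL ψ
  | X φ | G φ => IsNuLTL φ
  | F _ | U _ _ | M _ _ => False

/-- The fragment without greatest-fixed-point operators, whose formulas express co-safety
properties. -/
def IsMuLTL : LTL Ap → Prop
  | tt | ff | atom _ | natom _ => True
  | conj φ ψ | disj φ ψ | U φ ψ | M φ ψ => IsMuLTL φ ∧ IsMuLTL ψ
  | X φ | F φ => IsMuLTL φ
  | G _ | W _ _ | R _ _ => False

theorem isNuLTL_evalNu (S : Finset (LTL Ap)) (φ : LTL Ap) : IsNuLTL (evalNu S φ) := by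
  induction φ <;> simp only [evalNu] <;> (try split_ifs) <;> simp_all [IsNuLTL]

theorem isMuLTL_evalMu (T : Finset (LTL Ap)) (φ : LTL Ap) : IsMuLTL (evalMu T φ) := by
  induction φ <;> simp only [evalMu] <;> (try split_ifs) <;> simp_all [IsMuLTL]

/-- The truth value, under a propositional assignment, of the formula that remains of `φ` after
the first `i` letters of `w`. -/
def evalAfter (v : LTL Ap → Prop) (φ : LTL Ap) (w : ℕ → Set Ap) (i : ℕ) : Prop :=
  evalP v (afWord φ (wordPrefix w i))

section evalAfter

variable (v : LTL Ap → Prop) (φ ψ : LTL Ap) (w : ℕ → Set Ap) (i : ℕ)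

theorem evalAfter_succ :
    evalAfter v φ w (i + 1) ↔ evalAfter v (af φ (w 0)) (wordSuffix w 1) i := by
  rw [evalAfter, wordPrefix_succ']; rfl

theorem evalP_afWord_conj (u : List (Set Ap)) :
    evalP v (afWord (conj φ ψ) u) ↔ evalP v (afWord φ u) ∧ evalP v (afWord ψ u) := by
  induction u generalizing φ ψ with
  | nil => rfl
  | cons a u ih => exact ih _ _

theorem evalP_afWord_disj (u : List (Set Ap)) :
    evalP v (afWord (disj φ ψ) u) ↔ evalP v (afWord φ u) ∨ evalP v (afWord ψ u) := by
  induction u generalizing φ ψ with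
  | nil => rfl
  | cons a u ih => exact ih _ _

theorem afWord_tt (u : List (Set Ap)) : afWord tt u = tt := by
  induction u with
  | nil => rfl
  | cons a u ih => exact ih

theorem afWord_ff (u : List (Set Ap)) : afWord ff u = ff := by
  induction u with
  | nil => rfl
  | cons a u ih => exact ih

theorem evalAfter_tt : evalAfter v tt w i := by
  rw [evalAfter, afWord_tt]; trivial

theorem not_evalAfter_ff : ¬ evalAfter v ff w i := by
  rw [evalAfter, afWord_ff]; exact id

theorem evalAfter_conj :
    evalAfter v (conj φ ψ) w i ↔ evalAfter v φ w i ∧ evalAfter v ψ w i :=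
  evalP_afWord_conj _ _ _ _

theorem evalAfter_disj :
    evalAfter v (disj φ ψ) w i ↔ evalAfter v φ w i ∨ evalAfter v ψ w i :=
  evalP_afWord_disj _ _ _ _

theorem evalAfter_X_succ :
    evalAfter v (X φ) w (i + 1) ↔ evalAfter v φ (wordSuffix w 1) i := evalAfter_succ ..

theorem evalAfter_F_succ : evalAfter v (F φ) w (i + 1) ↔
    evalAfter v φ w (i + 1) ∨ evalAfter v (F φ) (wordSuffix w 1) i := by
  rw [evalAfter_succ, af, evalAfter_disj, ← evalAfter_succ]

theorem evalAfter_G_succ : evalAfter v (G φ) w (i + 1) ↔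
    evalAfter v φ w (i + 1) ∧ evalAfter v (G φ) (wordSuffix w 1) i := by
  rw [evalAfter_succ, af, evalAfter_conj, ← evalAfter_succ]

theorem evalAfter_U_succ : evalAfter v (U φ ψ) w (i + 1) ↔
    evalAfter v ψ w (i + 1) ∨
      (evalAfter v φ w (i + 1) ∧ evalAfter v (U φ ψ) (wordSuffix w 1) i) := by
  rw [evalAfter_succ, af, evalAfter_disj, evalAfter_conj, ← evalAfter_succ, ← evalAfter_succ]

theorem evalAfter_W_succ : evalAfter v (W φ ψ) w (i + 1) ↔
    evalAfter v ψ w (i + 1) ∨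
      (evalAfter v φ w (i + 1) ∧ evalAfter v (W φ ψ) (wordSuffix w 1) i) := by
  rw [evalAfter_succ, af, evalAfter_disj, evalAfter_conj, ← evalAfter_succ, ← evalAfter_succ]

theorem evalAfter_M_succ : evalAfter v (M φ ψ) w (i + 1) ↔
    evalAfter v ψ w (i + 1) ∧
      (evalAfter v φ w (i + 1) ∨ evalAfter v (M φ ψ) (wordSuffix w 1) i) := by
  rw [evalAfter_succ, af, evalAfter_conj, evalAfter_disj, ← evalAfter_succ, ← evalAfter_succ]

theorem evalAfter_R_succ : evalAfter v (R φ ψ) w (i + 1) ↔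
    evalAfter v ψ w (i + 1) ∧
      (evalAfter v φ w (i + 1) ∨ evalAfter v (R φ ψ) (wordSuffix w 1) i) := by
  rw [evalAfter_succ, af, evalAfter_conj, evalAfter_disj, ← evalAfter_succ, ← evalAfter_succ]

end evalAfter

theorem eventually_of_eventually_succ {p : ℕ → Prop} (h : ∀ᶠ i in atTop, p (i + 1)) :
    ∀ᶠ i in atTop, p i := by
  obtain ⟨N, hN⟩ := eventually_atTop.1 h
  refine eventually_atTop.2 ⟨N + 1, fun b hb => ?_⟩
  obtain ⟨c, rfl⟩ := Nat.exists_eq_add_of_le hb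
  simpa [add_right_comm] using hN (N + c) (by omega)

theorem eventually_succ {p : ℕ → Prop} (h : ∀ᶠ i in atTop, p i) : ∀ᶠ i in atTop, p (i + 1) :=
  (tendsto_add_atTop_nat 1).eventually h

/-- A violated safety formula is violated by a finite prefix, after which it has become
propositionally false. -/
theorem eventually_not_evalAfter {φ : LTL Ap} (hφ : IsNuLTL φ) {w : ℕ → Set Ap}
    (hw : ¬ Sat w φ) : ∀ᶠ i in atTop, ∀ v, ¬ evalAfter v φ w i := by
  induction φ generalizing w with
  | tt => exact absurd trivial hw
  | ff => exact Eventually.of_forall fun i v => not_evalAfter_ff v w i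
  | atom a =>
    refine eventually_of_eventually_succ (Eventually.of_forall fun i v => ?_)
    rw [evalAfter_succ, af, if_neg (by simpa [Sat] using hw)]
    exact not_evalAfter_ff _ _ _
  | natom a =>
    refine eventually_of_eventually_succ (Eventually.of_forall fun i v => ?_)
    rw [evalAfter_succ, af, if_pos (by simpa [Sat] using hw)]
    exact not_evalAfter_ff _ _ _
  | conj φ ψ h1 h2 =>
    simp only [Sat, not_and_or] at hw
    simp only [evalAfter_conj]
    rcases hw with hw | hw
    · filter_upwards [h1 hφ.1 hw] with i hi v h using hi v h.1
    · filter_upwards [h2 hφ.2 hw] with i hi v h using hi v h.2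
  | disj φ ψ h1 h2 =>
    simp only [Sat, not_or] at hw
    simp only [evalAfter_disj]
    filter_upwards [h1 hφ.1 hw.1, h2 hφ.2 hw.2] with i hi hi' v h using h.elim (hi v) (hi' v)
  | X φ h =>
    refine eventually_of_eventually_succ ?_
    simp only [evalAfter_X_succ]
    exact h hφ hw
  | G φ h =>
    simp only [Sat, not_forall] at hw
    obtain ⟨k, hk⟩ := hw
    induction k generalizing w with
    | zero =>
      refine eventually_of_eventually_succ ?_
      filter_upwards [eventually_succ (h hφ (by simpa using hk))] with i hi v hv
      exact hi v ((evalAfter_G_succ ..).1 hv).1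
    | succ k ih =>
      refine eventually_of_eventually_succ ?_
      filter_upwards [ih (w := wordSuffix w 1) (by simpa [add_comm] using hk)] with i hi v hv
      exact hi v ((evalAfter_G_succ ..).1 hv).2
  | W φ ψ h1 h2 =>
    -- at the first failure of `φ`, the formula `ψ` has not held yet
    obtain ⟨k, hk, hk'⟩ : ∃ k, ¬ Sat (wordSuffix w k) φ ∧ ∀ j ≤ k, ¬ Sat (wordSuffix w j) ψ := by
      simp only [Sat, not_or, not_forall, not_exists, not_and] at hw
      refine ⟨Nat.find hw.1, Nat.find_spec hw.1, fun j hj hs => ?_⟩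
      obtain ⟨i, hi, hi'⟩ := hw.2 j hs
      exact Nat.find_min hw.1 (hi.trans_le hj) hi'
    clear hw
    induction k generalizing w with
    | zero =>
      refine eventually_of_eventually_succ ?_
      filter_upwards [eventually_succ (h1 hφ.1 (by simpa using hk)),
        eventually_succ (h2 hφ.2 (by simpa using hk' 0 le_rfl))] with i hi hi' v hv
      exact ((evalAfter_W_succ ..).1 hv).elim (hi' v) fun h => hi v h.1
    | succ k ih =>
      refine eventually_of_eventually_succ ?_
      filter_upwards [eventually_succ (h2 hφ.2 (by simpa using hk' 0 (by omega))),
        ih (w := wordSuffix w 1) (by simpa [add_comm] using hk)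
          (fun j hj => by simpa [add_comm] using hk' (j + 1) (by omega))] with i hi hi' v hv
      exact ((evalAfter_W_succ ..).1 hv).elim (hi v) fun h => hi' v h.2
  | R φ ψ h1 h2 =>
    -- before the first failure of `ψ`, the formula `φ` has not held
    obtain ⟨k, hk, hk'⟩ : ∃ k, ¬ Sat (wordSuffix w k) ψ ∧ ∀ j < k, ¬ Sat (wordSuffix w j) φ := by
      simp only [Sat, not_or, not_forall, not_exists, not_and] at hw
      refine ⟨Nat.find hw.1, Nat.find_spec hw.1, fun j hj hs => ?_⟩
      obtain ⟨i, hi, hi'⟩ := hw.2 j hs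
      exact Nat.find_min hw.1 (hi.trans_lt hj) hi'
    clear hw
    induction k generalizing w with
    | zero =>
      refine eventually_of_eventually_succ ?_
      filter_upwards [eventually_succ (h2 hφ.2 (by simpa using hk))] with i hi v hv
      exact hi v ((evalAfter_R_succ ..).1 hv).1
    | succ k ih =>
      refine eventually_of_eventually_succ ?_
      filter_upwards [eventually_succ (h1 hφ.1 (by simpa using hk' 0 (by omega))),
        ih (w := wordSuffix w 1) (by simpa [add_comm] using hk)
          (fun j hj => by simpa [add_comm] using hk' (j + 1) (by omega))] with i hi hi' v hv
      exact ((evalAfter_R_succ ..).1 hv).2.elim (hi v) (hi' v)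
  | F φ h => exact hφ.elim
  | U φ ψ h1 h2 => exact hφ.elim
  | M φ ψ h1 h2 => exact hφ.elim

/-- A satisfied co-safety formula is satisfied because of a finite prefix, after which it has
become propositionally true. -/
theorem eventually_evalAfter {φ : LTL Ap} (hφ : IsMuLTL φ) {w : ℕ → Set Ap}
    (hw : Sat w φ) : ∀ᶠ i in atTop, ∀ v, evalAfter v φ w i := by
  induction φ generalizing w with
  | tt => exact Eventually.of_forall fun i v => evalAfter_tt v w i
  | ff => exact hw.elim
  | atom a =>
    refine eventually_of_eventually_succ (Eventually.of_forall fun i v => ?_)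
    rw [evalAfter_succ, af, if_pos (by simpa [Sat] using hw)]
    exact evalAfter_tt ..
  | natom a =>
    refine eventually_of_eventually_succ (Eventually.of_forall fun i v => ?_)
    rw [evalAfter_succ, af, if_neg (by simpa [Sat] using hw)]
    exact evalAfter_tt ..
  | conj φ ψ h1 h2 =>
    simp only [evalAfter_conj]
    filter_upwards [h1 hφ.1 hw.1, h2 hφ.2 hw.2] with i hi hi' v using ⟨hi v, hi' v⟩
  | disj φ ψ h1 h2 =>
    simp only [evalAfter_disj]
    rcases hw with hw | hw
    · filter_upwards [h1 hφ.1 hw] with i hi v using .inl (hi v)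
    · filter_upwards [h2 hφ.2 hw] with i hi v using .inr (hi v)
  | X φ h =>
    refine eventually_of_eventually_succ ?_
    simp only [evalAfter_X_succ]
    exact h hφ hw
  | F φ h =>
    simp only [Sat] at hw
    obtain ⟨k, hk⟩ := hw
    induction k generalizing w with
    | zero =>
      refine eventually_of_eventually_succ ?_
      filter_upwards [eventually_succ (h hφ (by simpa using hk))] with i hi v
      exact (evalAfter_F_succ ..).2 (.inl (hi v))
    | succ k ih =>
      refine eventually_of_eventually_succ ?_
      filter_upwards [ih (w := wordSuffix w 1) (by simpa [add_comm] using hk)] with i hi v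
      exact (evalAfter_F_succ ..).2 (.inr (hi v))
  | U φ ψ h1 h2 =>
    simp only [Sat] at hw
    obtain ⟨k, hk, hk'⟩ := hw
    induction k generalizing w with
    | zero =>
      refine eventually_of_eventually_succ ?_
      filter_upwards [eventually_succ (h2 hφ.2 (by simpa using hk))] with i hi v
      exact (evalAfter_U_succ ..).2 (.inl (hi v))
    | succ k ih =>
      refine eventually_of_eventually_succ ?_
      filter_upwards [eventually_succ (h1 hφ.1 (by simpa using hk' 0 (by omega))),
        ih (w := wordSuffix w 1) (by simpa [add_comm] using hk)
          (fun j hj => by simpa [add_comm] using hk' (j + 1) (by omega))] with i hi hi' v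
      exact (evalAfter_U_succ ..).2 (.inr ⟨hi v, hi' v⟩)
  | M φ ψ h1 h2 =>
    simp only [Sat] at hw
    obtain ⟨k, hk, hk'⟩ := hw
    induction k generalizing w with
    | zero =>
      refine eventually_of_eventually_succ ?_
      filter_upwards [eventually_succ (h1 hφ.1 (by simpa using hk)),
        eventually_succ (h2 hφ.2 (by simpa using hk' 0 le_rfl))] with i hi hi' v
      exact (evalAfter_M_succ ..).2 ⟨hi' v, .inl (hi v)⟩
    | succ k ih =>
      refine eventually_of_eventually_succ ?_
      filter_upwards [eventually_succ (h2 hφ.2 (by simpa using hk' 0 (by omega))),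
        ih (w := wordSuffix w 1) (by simpa [add_comm] using hk)
          (fun j hj => by simpa [add_comm] using hk' (j + 1) (by omega))] with i hi hi' v
      exact (evalAfter_M_succ ..).2 ⟨hi v, .inr (hi' v)⟩
  | G φ h => exact hφ.elim
  | W φ ψ h1 h2 => exact hφ.elim
  | R φ ψ h1 h2 => exact hφ.elim

/-! ### Monitors that restart -/

theorem afCls_cls_afWord (χ : LTL Ap) (w : ℕ → Set Ap) (j k : ℕ) :
    afCls (cls (afWord χ (wordPrefix (wordSuffix w j) k))) (w (j + k)) =
      cls (afWord χ (wordPrefix (wordSuffix w j) (k + 1))) := by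
  rw [afWord_wordPrefix_succ]; rfl

/-- A monitor that follows a safety formula `χ j` from some position `j` on, and takes up a later
one whenever it is in the state `ff`, is in that state only finitely often exactly when some
`χ j` holds at `j`, provided that this is inherited by later positions. -/
theorem eventually_ne_ff_iff (w : ℕ → Set Ap) (χ : ℕ → LTL Ap) (hχ : ∀ j, IsNuLTL (χ j))
    (mono : ∀ j, Sat (wordSuffix w j) (χ j) → Sat (wordSuffix w (j + 1)) (χ (j + 1)))
    (c : ℕ → PropClass Ap) (h0 : c 0 = cls (χ 0))
    (hff : ∀ n, c n = cls ff → ∃ j k, n ≤ j ∧ j + k = n + 1 ∧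
      c (n + 1) = cls (afWord (χ j) (wordPrefix (wordSuffix w j) k)))
    (hstep : ∀ n, c n ≠ cls ff → c (n + 1) = afCls (c n) (w n)) :
    (∀ᶠ n in atTop, c n ≠ cls ff) ↔ ∃ j, Sat (wordSuffix w j) (χ j) := by
  constructor
  · intro h
    have inv : ∀ n, ∃ j k, j + k = n ∧
        c n = cls (afWord (χ j) (wordPrefix (wordSuffix w j) k)) := by
      intro n
      induction n with
      | zero => exact ⟨0, 0, rfl, h0⟩
      | succ n ih =>
        by_cases hn : c n = cls ff
        · obtain ⟨j, k, -, hjk, h⟩ := hff n hn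
          exact ⟨j, k, hjk, h⟩
        · obtain ⟨j, k, hjk, h⟩ := ih
          refine ⟨j, k + 1, by omega, ?_⟩
          rw [hstep n hn, h, ← hjk, afCls_cls_afWord]
    obtain ⟨N, hN⟩ := eventually_atTop.1 h
    obtain ⟨j, k, hjk, hc⟩ := inv N
    have run : ∀ i, c (N + i) = cls (afWord (χ j) (wordPrefix (wordSuffix w j) (k + i))) := by
      intro i
      induction i with
      | zero => exact hc
      | succ i ih =>
        rw [← add_assoc, hstep _ (hN _ (by omega)), ih, ← hjk, add_assoc, afCls_cls_afWord]
        rfl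
    refine ⟨j, by_contra fun hs => ?_⟩
    obtain ⟨m, hm⟩ := eventually_atTop.1 (eventually_not_evalAfter (hχ j) hs)
    refine hN (N + m) (by omega) ?_
    rw [run, cls_eq_ff_iff]
    exact hm (k + m) (by omega)
  · rintro ⟨m, hm⟩
    by_contra hcon
    simp only [not_eventually, not_not] at hcon
    obtain ⟨n, hn, hcn⟩ := frequently_atTop.1 hcon m
    obtain ⟨j, k, hj, hjk, hc⟩ := hff n hcn
    have hsat : Sat (wordSuffix w j) (χ j) := by
      have hmj : m ≤ j := hn.trans hj
      clear * - hmj hm mono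
      induction j, hmj using Nat.le_induction with
      | base => exact hm
      | succ j _ ih => exact mono j ih
    -- the formula taken up at the restart holds, so it never becomes `ff`
    have ne : ∀ i, cls (afWord (χ j) (wordPrefix (wordSuffix w j) i)) ≠ cls ff := fun i h =>
      not_sat_of_cls_eq_ff h (wordSuffix (wordSuffix w j) i) ((sat_afWord_iff _ _ _).2 hsat)
    have run : ∀ i, c (n + 1 + i) =
        cls (afWord (χ j) (wordPrefix (wordSuffix w j) (k + i))) := by
      intro i
      induction i with
      | zero => exact hc
      | succ i ih =>
        rw [← add_assoc, hstep _ (ih ▸ ne _), ih, ← hjk, add_assoc, afCls_cls_afWord]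
        rfl
    obtain ⟨n', hn', hcn'⟩ := frequently_atTop.1 hcon (n + 1)
    obtain ⟨i, rfl⟩ := Nat.exists_eq_add_of_le hn'
    exact ne _ ((run i).symm.trans hcn')

theorem sat_GF_iff_frequently (w : ℕ → Set Ap) (φ : LTL Ap) :
    Sat w (G (F φ)) ↔ ∃ᶠ n in atTop, Sat (wordSuffix w n) φ := by
  simp only [Sat, wordSuffix_wordSuffix, frequently_atTop]
  constructor
  · intro h a
    obtain ⟨k, hk⟩ := h a
    exact ⟨a + k, by omega, hk⟩
  · intro h a
    obtain ⟨b, hb, h⟩ := h a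
    obtain ⟨k, rfl⟩ := Nat.exists_eq_add_of_le hb
    exact ⟨k, h⟩

theorem sat_FG_iff_eventually (w : ℕ → Set Ap) (φ : LTL Ap) :
    Sat w (F (G φ)) ↔ ∀ᶠ n in atTop, Sat (wordSuffix w n) φ := by
  simp only [Sat, wordSuffix_wordSuffix, eventually_atTop]
  constructor
  · rintro ⟨a, h⟩
    refine ⟨a, fun b hb => ?_⟩
    obtain ⟨k, rfl⟩ := Nat.exists_eq_add_of_le hb
    exact h k
  · rintro ⟨a, h⟩
    exact ⟨a, fun k => h _ (by omega)⟩

theorem sat_suffix_GF_iff (w : ℕ → Set Ap) (φ : LTL Ap) (i : ℕ) :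
    Sat (wordSuffix w i) (G (F φ)) ↔ Sat w (G (F φ)) := by
  simp only [sat_GF_iff_frequently, wordSuffix_wordSuffix, add_comm i]
  have := @frequently_map ℕ ℕ atTop (fun n => n + i) (fun n => Sat (wordSuffix w n) φ)
  rw [← this, map_add_atTop_eq_nat]

theorem sat_suffix_FG_iff (w : ℕ → Set Ap) (φ : LTL Ap) (i : ℕ) :
    Sat (wordSuffix w i) (F (G φ)) ↔ Sat w (F (G φ)) := by
  simp only [sat_FG_iff_eventually, wordSuffix_wordSuffix, add_comm i]
  have := @eventually_map ℕ ℕ atTop (fun n => n + i) (fun n => Sat (wordSuffix w n) φ)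
  rw [← this, map_add_atTop_eq_nat]

/-- The monitored formula is `G φ` at every position. A restart at the position `n` skips the letter
at `n`, which does not matter for a property of the tail. -/
theorem eventually_not_mem_fgRej_iff (φ : LTL Ap) (hφ : IsNuLTL φ) (w : ℕ → Set Ap) :
    (∀ᶠ n in atTop, (fgPre φ).run w n ∉ fgRej φ) ↔ Sat w (F (G φ)) := by
  refine eventually_ne_ff_iff w (fun _ => G φ) (fun _ => hφ) (fun j h => ?_)
    (fun n => ((fgPre φ).run w n).1) rfl (fun n hn => ⟨n + 1, 0, by omega, rfl, ?_⟩)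
    (fun n hn => ?_)
  · simpa using ((sat_G_iff _ _).1 h).2
  · simp only [DetPre.run, fgPre] at hn ⊢
    rw [if_pos hn]; rfl
  · simp only [DetPre.run, fgPre] at hn ⊢
    rw [if_neg hn]

/-- Between two visits of `tt` the automaton has checked `F φ` from scratch, and a check of `F φ`
that never reaches `tt` refutes `F φ`. -/
theorem frequently_mem_gfAcc_iff (φ : LTL Ap) (hφ : IsMuLTL φ) (w : ℕ → Set Ap) :
    (∃ᶠ n in atTop, (gfPre φ).run w n ∈ gfAcc φ) ↔ Sat w (G (F φ)) := by
  set c : ℕ → PropClass Ap := fun n => ((gfPre φ).run w n).1 with hc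
  have htt : ∀ n, c n = cls tt → c (n + 1) = cls (F φ) := by
    intro n hn
    simp only [hc, DetPre.run, gfPre] at hn ⊢
    rw [if_pos hn]
  have hstep : ∀ n, c n ≠ cls tt → c (n + 1) = afCls (c n) (w n) := by
    intro n hn
    simp only [hc, DetPre.run, gfPre] at hn ⊢
    rw [if_neg hn]
  have inv : ∀ n, ∃ j k, j + k = n ∧
      c n = cls (afWord (F φ) (wordPrefix (wordSuffix w j) k)) := by
    intro n
    induction n with
    | zero => exact ⟨0, 0, rfl, rfl⟩
    | succ n ih =>
      by_cases hn : c n = cls tt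
      · exact ⟨n + 1, 0, rfl, htt n hn⟩
      · obtain ⟨j, k, hjk, h⟩ := ih
        refine ⟨j, k + 1, by omega, ?_⟩
        rw [hstep n hn, h, ← hjk, afCls_cls_afWord]
  change (∃ᶠ n in atTop, c n = cls tt) ↔ _
  constructor
  · intro h m
    obtain ⟨n, hn, hcn⟩ := frequently_atTop.1 h m
    -- the first visit of `tt` after the restart at `n + 1`
    have hex : ∃ i, c (n + 1 + i) = cls tt := by
      obtain ⟨n', hn', h'⟩ := frequently_atTop.1 h (n + 1)
      obtain ⟨i, rfl⟩ := Nat.exists_eq_add_of_le hn'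
      exact ⟨i, h'⟩
    have run : ∀ i, i ≤ Nat.find hex →
        c (n + 1 + i) = cls (afWord (F φ) (wordPrefix (wordSuffix w (n + 1)) i)) := by
      intro i hi
      induction i with
      | zero => exact htt n hcn
      | succ i ih =>
        rw [← add_assoc, hstep _ (Nat.find_min hex (by omega)), ih (by omega),
          afCls_cls_afWord]
    have hfin := (run _ le_rfl).symm.trans (Nat.find_spec hex)
    have hsat : Sat (wordSuffix w (n + 1)) (F φ) :=
      (sat_afWord_iff _ _ (Nat.find hex)).1 (sat_of_cls_eq_tt hfin _)
    obtain ⟨k, hk⟩ := hsat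
    refine ⟨n + 1 - m + k, ?_⟩
    rw [wordSuffix_wordSuffix] at hk ⊢
    convert hk using 2
    omega
  · intro h
    by_contra hcon
    obtain ⟨N, hN⟩ := eventually_atTop.1 (not_frequently.1 hcon)
    obtain ⟨j, k, hjk, hcN⟩ := inv N
    have run : ∀ i, c (N + i) = cls (afWord (F φ) (wordPrefix (wordSuffix w j) (k + i))) := by
      intro i
      induction i with
      | zero => exact hcN
      | succ i ih =>
        rw [← add_assoc, hstep _ (hN _ (by omega)), ih, ← hjk, add_assoc, afCls_cls_afWord]
        rfl
    obtain ⟨m, hm⟩ := eventually_atTop.1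
      (eventually_evalAfter (φ := F φ) (w := wordSuffix w j) hφ (h j))
    refine hN (N + m) (by omega) ?_
    rw [run, cls_eq_tt_iff]
    exact hm (k + m) (by omega)

/-! ### Formulas with advice -/

/-- Advice that holds for what is left of a formula stays correct after the next letter. -/
theorem sat_evalNu_af (S : Finset (LTL Ap)) (φ : LTL Ap) {w : ℕ → Set Ap}
    (h : Sat w (evalNu S φ)) : Sat (wordSuffix w 1) (evalNu S (af φ (w 0))) := by
  induction φ with
  | tt => exact h
  | ff => exact h
  | atom a =>
    have : a ∈ w 0 := h
    simp [af, evalNu, this, Sat]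
  | natom a =>
    have : a ∉ w 0 := h
    simp [af, evalNu, this, Sat]
  | conj φ ψ h1 h2 => exact ⟨h1 h.1, h2 h.2⟩
  | disj φ ψ h1 h2 => exact h.imp h1 h2
  | X φ _ => exact h
  | F φ h1 =>
    by_cases hS : F φ ∈ S
    · exact .inr (by rw [evalNu, if_pos hS]; trivial)
    · rw [evalNu, if_neg hS] at h; exact h.elim
  | G φ h1 =>
    rw [evalNu, sat_G_iff] at h
    exact ⟨h1 h.1, h.2⟩
  | U φ ψ h1 h2 =>
    by_cases hS : U φ ψ ∈ S
    · rw [evalNu, if_pos hS, sat_W_iff] at h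
      refine h.imp h2 fun h => ⟨h1 h.1, ?_⟩
      rw [evalNu, if_pos hS]; exact h.2
    · rw [evalNu, if_neg hS] at h; exact h.elim
  | W φ ψ h1 h2 =>
    rw [evalNu, sat_W_iff] at h
    exact h.imp h2 fun h => ⟨h1 h.1, h.2⟩
  | M φ ψ h1 h2 =>
    by_cases hS : M φ ψ ∈ S
    · rw [evalNu, if_pos hS, sat_R_iff] at h
      refine ⟨h2 h.1, h.2.imp h1 fun h => ?_⟩
      rw [evalNu, if_pos hS]; exact h
    · rw [evalNu, if_neg hS] at h; exact h.elim
  | R φ ψ h1 h2 =>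
    rw [evalNu, sat_R_iff] at h
    exact ⟨h2 h.1, h.2.imp h1 id⟩

theorem self_mem_sf (φ : LTL Ap) : φ ∈ sf φ := by
  cases φ <;> simp [sf]

theorem sf_subset_of_mem {φ ψ : LTL Ap} (h : ψ ∈ sf φ) : sf ψ ⊆ sf φ := by
  induction φ with
  | tt | ff | atom a | natom a => simp only [sf, Finset.mem_singleton] at h; rw [h]
  | conj φ₁ φ₂ h1 h2 | disj φ₁ φ₂ h1 h2 | U φ₁ φ₂ h1 h2 | W φ₁ φ₂ h1 h2 | M φ₁ φ₂ h1 h2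
  | R φ₁ φ₂ h1 h2 =>
    simp only [sf, Finset.mem_insert, Finset.mem_union] at h
    rcases h with rfl | h | h
    · exact subset_rfl
    · exact (h1 h).trans fun x hx => by simp [sf, hx]
    · exact (h2 h).trans fun x hx => by simp [sf, hx]
  | X φ h1 | F φ h1 | G φ h1 =>
    simp only [sf, Finset.mem_insert] at h
    rcases h with rfl | h
    · exact subset_rfl
    · exact (h1 h).trans fun x hx => by simp [sf, hx]

theorem length_lt_of_mem_sf {φ ψ : LTL Ap} (h : ψ ∈ sf φ) : ψ = φ ∨ ψ.length < φ.length := by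
  induction φ with
  | tt | ff | atom a | natom a => exact .inl (by simpa [sf] using h)
  | conj φ₁ φ₂ h1 h2 | disj φ₁ φ₂ h1 h2 | U φ₁ φ₂ h1 h2 | W φ₁ φ₂ h1 h2 | M φ₁ φ₂ h1 h2
  | R φ₁ φ₂ h1 h2 =>
    simp only [sf, Finset.mem_insert, Finset.mem_union] at h
    rcases h with h | h | h
    · exact .inl h
    · rcases h1 h with rfl | h <;> right <;> simp only [length] <;> omega
    · rcases h2 h with rfl | h <;> right <;> simp only [length] <;> omega
  | X φ h1 | F φ h1 | G φ h1 =>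
    simp only [sf, Finset.mem_insert] at h
    rcases h with h | h
    · exact .inl h
    · rcases h1 h with rfl | h <;> right <;> simp only [length] <;> omega

/-- `af` creates no new least-fixed-point subformulas. -/
theorem mem_sf_of_mem_sf_af {φ χ : LTL Ap} {ν : Set Ap} (h : χ ∈ sf (af φ ν)) (hχ : IsMu χ) :
    χ ∈ sf φ := by
  induction φ with
  | tt | ff => exact h
  | atom a | natom a =>
    simp only [af] at h
    split_ifs at h <;> simp only [sf, Finset.mem_singleton] at h <;> subst h <;> exact hχ.elim
  | X φ _ => simpa [sf] using .inr h
  | conj φ ψ h1 h2 | disj φ ψ h1 h2 =>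
    simp only [af, sf, Finset.mem_insert, Finset.mem_union] at h ⊢
    rcases h with rfl | h | h
    · exact hχ.elim
    · exact .inr (.inl (h1 h))
    · exact .inr (.inr (h2 h))
  | F φ h1 | G φ h1 =>
    simp only [af, sf, Finset.mem_insert, Finset.mem_union] at h ⊢
    rcases h with rfl | h | h
    · exact hχ.elim
    · exact .inr (h1 h)
    · exact h
  | U φ ψ h1 h2 | W φ ψ h1 h2 | M φ ψ h1 h2 | R φ ψ h1 h2 =>
    simp only [af, sf, Finset.mem_insert, Finset.mem_union] at h ⊢
    rcases h with rfl | h | rfl | h | h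
    · exact hχ.elim
    · exact .inr (.inr (h2 h))
    · exact hχ.elim
    · exact .inr (.inl (h1 h))
    · exact h

theorem mem_sf_of_mem_sf_afWord {φ χ : LTL Ap} {u : List (Set Ap)} (h : χ ∈ sf (afWord φ u))
    (hχ : IsMu χ) : χ ∈ sf φ := by
  induction u generalizing φ with
  | nil => exact h
  | cons a u ih => exact mem_sf_of_mem_sf_af (ih h) hχ

theorem sat_F_of_suffix {w : ℕ → Set Ap} {φ : LTL Ap} {i : ℕ} (h : Sat (wordSuffix w i) (F φ)) :
    Sat w (F φ) := by
  obtain ⟨k, hk⟩ := h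
  exact ⟨i + k, by simpa using hk⟩

theorem sat_G_suffix {w : ℕ → Set Ap} {φ : LTL Ap} (h : Sat w (G φ)) (i : ℕ) :
    Sat (wordSuffix w i) (G φ) := fun k => by simpa using h (i + k)

/-- Advice that contains all least-fixed-point subformulas that still hold at some point weakens the
formula: replacing `U` by `W` loses nothing, and only false formulas are replaced by `ff`. -/
theorem sat_evalNu_of_sat {S : Finset (LTL Ap)} {φ : LTL Ap} {w : ℕ → Set Ap}
    (hS : ∀ ψ ∈ sf φ, IsMu ψ → Sat w (F ψ) → ψ ∈ S) (h : Sat w φ) : Sat w (evalNu S φ) := by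
  induction φ generalizing w with
  | tt | ff | atom a | natom a => exact h
  | conj φ ψ h1 h2 =>
    exact ⟨h1 (fun χ hχ => hS χ (by simp [sf, hχ])) h.1,
      h2 (fun χ hχ => hS χ (by simp [sf, hχ])) h.2⟩
  | disj φ ψ h1 h2 =>
    exact h.imp (h1 fun χ hχ => hS χ (by simp [sf, hχ])) (h2 fun χ hχ => hS χ (by simp [sf, hχ]))
  | X φ h1 =>
    exact h1 (fun χ hχ hm hF => hS χ (by simp [sf, hχ]) hm (sat_F_of_suffix hF)) h
  | F φ h1 =>
    have : F φ ∈ S := hS _ (self_mem_sf _) trivial ⟨0, by simpa using h⟩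
    rw [evalNu, if_pos this]; trivial
  | G φ h1 =>
    exact fun k =>
      h1 (fun χ hχ hm hF => hS χ (by simp [sf, hχ]) hm (sat_F_of_suffix hF)) (h k)
  | U φ ψ h1 h2 =>
    have hm : U φ ψ ∈ S := hS _ (self_mem_sf _) trivial ⟨0, by simpa using h⟩
    obtain ⟨k, hk, hk'⟩ := h
    rw [evalNu, if_pos hm]
    exact .inr ⟨k,
      h2 (fun χ hχ hm hF => hS χ (by simp [sf, hχ]) hm (sat_F_of_suffix hF)) hk, fun j hj =>
      h1 (fun χ hχ hm hF => hS χ (by simp [sf, hχ]) hm (sat_F_of_suffix hF)) (hk' j hj)⟩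
  | M φ ψ h1 h2 =>
    have hm : M φ ψ ∈ S := hS _ (self_mem_sf _) trivial ⟨0, by simpa using h⟩
    obtain ⟨k, hk, hk'⟩ := h
    rw [evalNu, if_pos hm]
    exact .inr ⟨k,
      h1 (fun χ hχ hm hF => hS χ (by simp [sf, hχ]) hm (sat_F_of_suffix hF)) hk, fun j hj =>
      h2 (fun χ hχ hm hF => hS χ (by simp [sf, hχ]) hm (sat_F_of_suffix hF)) (hk' j hj)⟩
  | W φ ψ h1 h2 =>
    have i1 := fun k => h1 (w := wordSuffix w k)
      (fun χ hχ hm hF => hS χ (by simp [sf, hχ]) hm (sat_F_of_suffix hF))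
    have i2 := fun k => h2 (w := wordSuffix w k)
      (fun χ hχ hm hF => hS χ (by simp [sf, hχ]) hm (sat_F_of_suffix hF))
    exact h.imp (fun h k => i1 k (h k))
      fun ⟨k, hk, hk'⟩ => ⟨k, i2 k hk, fun j hj => i1 j (hk' j hj)⟩
  | R φ ψ h1 h2 =>
    have i1 := fun k => h1 (w := wordSuffix w k)
      (fun χ hχ hm hF => hS χ (by simp [sf, hχ]) hm (sat_F_of_suffix hF))
    have i2 := fun k => h2 (w := wordSuffix w k)
      (fun χ hχ hm hF => hS χ (by simp [sf, hχ]) hm (sat_F_of_suffix hF))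
    exact h.imp (fun h k => i2 k (h k))
      fun ⟨k, hk, hk'⟩ => ⟨k, i1 k hk, fun j hj => i2 j (hk' j hj)⟩

/-- If all the advice holds infinitely often, the least-fixed-point obligations dropped by the
advice are met, so the formula with advice implies the formula. -/
theorem sat_of_sat_evalNu {S : Finset (LTL Ap)} {φ : LTL Ap} {w : ℕ → Set Ap}
    (hS : ∀ ψ ∈ S, ψ ∈ sf φ → Sat w (G (F ψ))) (h : Sat w (evalNu S φ)) : Sat w φ := by
  induction φ generalizing w with
  | tt | ff | atom a | natom a => exact h
  | conj φ ψ h1 h2 =>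
    exact ⟨h1 (fun χ hχ hs => hS χ hχ (by simp [sf, hs])) h.1,
      h2 (fun χ hχ hs => hS χ hχ (by simp [sf, hs])) h.2⟩
  | disj φ ψ h1 h2 =>
    exact h.imp (h1 fun χ hχ hs => hS χ hχ (by simp [sf, hs]))
      (h2 fun χ hχ hs => hS χ hχ (by simp [sf, hs]))
  | X φ h1 =>
    exact h1 (fun χ hχ hs => (sat_suffix_GF_iff _ _ _).2 (hS χ hχ (by simp [sf, hs]))) h
  | F φ h1 =>
    by_cases hm : F φ ∈ S
    · obtain ⟨k, hk⟩ := hS _ hm (self_mem_sf _) 0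
      rw [wordSuffix_zero] at hk
      exact sat_F_of_suffix hk
    · rw [evalNu, if_neg hm] at h; exact h.elim
  | G φ h1 =>
    exact fun k =>
      h1 (fun χ hχ hs => (sat_suffix_GF_iff _ _ _).2 (hS χ hχ (by simp [sf, hs]))) (h k)
  | U φ ψ h1 h2 =>
    have i1 := fun k => h1 (w := wordSuffix w k)
      (fun χ hχ hs => (sat_suffix_GF_iff _ _ _).2 (hS χ hχ (by simp [sf, hs])))
    have i2 := fun k => h2 (w := wordSuffix w k)
      (fun χ hχ hs => (sat_suffix_GF_iff _ _ _).2 (hS χ hχ (by simp [sf, hs])))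
    by_cases hm : U φ ψ ∈ S
    · rw [evalNu, if_pos hm] at h
      rcases h with h | ⟨k, hk, hk'⟩
      · obtain ⟨k, l, hl, -⟩ := hS _ hm (self_mem_sf _) 0
        exact ⟨k + l, by simpa using hl, fun j _ => i1 j (h j)⟩
      · exact ⟨k, i2 k hk, fun j hj => i1 j (hk' j hj)⟩
    · rw [evalNu, if_neg hm] at h; exact h.elim
  | M φ ψ h1 h2 =>
    have i1 := fun k => h1 (w := wordSuffix w k)
      (fun χ hχ hs => (sat_suffix_GF_iff _ _ _).2 (hS χ hχ (by simp [sf, hs])))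
    have i2 := fun k => h2 (w := wordSuffix w k)
      (fun χ hχ hs => (sat_suffix_GF_iff _ _ _).2 (hS χ hχ (by simp [sf, hs])))
    by_cases hm : M φ ψ ∈ S
    · rw [evalNu, if_pos hm] at h
      rcases h with h | ⟨k, hk, hk'⟩
      · obtain ⟨k, l, hl, -⟩ := hS _ hm (self_mem_sf _) 0
        exact ⟨k + l, by simpa using hl, fun j _ => i2 j (h j)⟩
      · exact ⟨k, i1 k hk, fun j hj => i2 j (hk' j hj)⟩
    · rw [evalNu, if_neg hm] at h; exact h.elim
  | W φ ψ h1 h2 =>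
    have i1 := fun k => h1 (w := wordSuffix w k)
      (fun χ hχ hs => (sat_suffix_GF_iff _ _ _).2 (hS χ hχ (by simp [sf, hs])))
    have i2 := fun k => h2 (w := wordSuffix w k)
      (fun χ hχ hs => (sat_suffix_GF_iff _ _ _).2 (hS χ hχ (by simp [sf, hs])))
    exact Or.imp (fun h k => i1 k (h k))
      (fun ⟨k, hk, hk'⟩ => ⟨k, i2 k hk, fun j hj => i1 j (hk' j hj)⟩) h
  | R φ ψ h1 h2 =>
    have i1 := fun k => h1 (w := wordSuffix w k)
      (fun χ hχ hs => (sat_suffix_GF_iff _ _ _).2 (hS χ hχ (by simp [sf, hs])))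
    have i2 := fun k => h2 (w := wordSuffix w k)
      (fun χ hχ hs => (sat_suffix_GF_iff _ _ _).2 (hS χ hχ (by simp [sf, hs])))
    exact Or.imp (fun h k => i2 k (h k))
      (fun ⟨k, hk, hk'⟩ => ⟨k, i1 k hk, fun j hj => i2 j (hk' j hj)⟩) h

/-- Advice that contains all greatest-fixed-point subformulas that hold from some point on weakens
the formula: a weak until outside of it does not hold forever, hence is a strong until. -/
theorem sat_evalMu_of_sat {T : Finset (LTL Ap)} {φ : LTL Ap} {w : ℕ → Set Ap}
    (hT : ∀ ψ ∈ sf φ, IsNu ψ → Sat w (F (G ψ)) → ψ ∈ T) (h : Sat w φ) : Sat w (evalMu T φ) := by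
  induction φ generalizing w with
  | tt | ff | atom a | natom a => exact h
  | conj φ ψ h1 h2 =>
    exact ⟨h1 (fun χ hχ => hT χ (by simp [sf, hχ])) h.1,
      h2 (fun χ hχ => hT χ (by simp [sf, hχ])) h.2⟩
  | disj φ ψ h1 h2 =>
    exact h.imp (h1 fun χ hχ => hT χ (by simp [sf, hχ])) (h2 fun χ hχ => hT χ (by simp [sf, hχ]))
  | X φ h1 =>
    exact h1 (fun χ hχ hm hF => hT χ (by simp [sf, hχ]) hm ((sat_suffix_FG_iff _ _ _).1 hF)) h
  | F φ h1 =>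
    obtain ⟨k, hk⟩ := h
    exact ⟨k,
      h1 (fun χ hχ hm hF => hT χ (by simp [sf, hχ]) hm ((sat_suffix_FG_iff _ _ _).1 hF)) hk⟩
  | G φ h1 =>
    have : G φ ∈ T := hT _ (self_mem_sf _) trivial ⟨0, fun k => sat_G_suffix (by simpa using h) k⟩
    rw [evalMu, if_pos this]; trivial
  | U φ ψ h1 h2 =>
    have i1 := fun k => h1 (w := wordSuffix w k)
      (fun χ hχ hm hF => hT χ (by simp [sf, hχ]) hm ((sat_suffix_FG_iff _ _ _).1 hF))
    have i2 := fun k => h2 (w := wordSuffix w k)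
      (fun χ hχ hm hF => hT χ (by simp [sf, hχ]) hm ((sat_suffix_FG_iff _ _ _).1 hF))
    obtain ⟨k, hk, hk'⟩ := h
    exact ⟨k, i2 k hk, fun j hj => i1 j (hk' j hj)⟩
  | M φ ψ h1 h2 =>
    have i1 := fun k => h1 (w := wordSuffix w k)
      (fun χ hχ hm hF => hT χ (by simp [sf, hχ]) hm ((sat_suffix_FG_iff _ _ _).1 hF))
    have i2 := fun k => h2 (w := wordSuffix w k)
      (fun χ hχ hm hF => hT χ (by simp [sf, hχ]) hm ((sat_suffix_FG_iff _ _ _).1 hF))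
    obtain ⟨k, hk, hk'⟩ := h
    exact ⟨k, i1 k hk, fun j hj => i2 j (hk' j hj)⟩
  | W φ ψ h1 h2 =>
    have i1 := fun k => h1 (w := wordSuffix w k)
      (fun χ hχ hm hF => hT χ (by simp [sf, hχ]) hm ((sat_suffix_FG_iff _ _ _).1 hF))
    have i2 := fun k => h2 (w := wordSuffix w k)
      (fun χ hχ hm hF => hT χ (by simp [sf, hχ]) hm ((sat_suffix_FG_iff _ _ _).1 hF))
    by_cases hm : W φ ψ ∈ T
    · rw [evalMu, if_pos hm]; trivial
    · rw [evalMu, if_neg hm]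
      rcases h with h | ⟨k, hk, hk'⟩
      · -- `G φ` would make `W φ ψ` hold forever
        refine absurd (hT _ (self_mem_sf _) trivial ⟨0, fun k => .inl fun l => ?_⟩) hm
        simpa using h (k + l)
      · exact ⟨k, i2 k hk, fun j hj => i1 j (hk' j hj)⟩
  | R φ ψ h1 h2 =>
    have i1 := fun k => h1 (w := wordSuffix w k)
      (fun χ hχ hm hF => hT χ (by simp [sf, hχ]) hm ((sat_suffix_FG_iff _ _ _).1 hF))
    have i2 := fun k => h2 (w := wordSuffix w k)
      (fun χ hχ hm hF => hT χ (by simp [sf, hχ]) hm ((sat_suffix_FG_iff _ _ _).1 hF))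
    by_cases hm : R φ ψ ∈ T
    · rw [evalMu, if_pos hm]; trivial
    · rw [evalMu, if_neg hm]
      rcases h with h | ⟨k, hk, hk'⟩
      · -- `G ψ` would make `R φ ψ` hold forever
        refine absurd (hT _ (self_mem_sf _) trivial ⟨0, fun k => .inl fun l => ?_⟩) hm
        simpa using h (k + l)
      · exact ⟨k, i1 k hk, fun j hj => i2 j (hk' j hj)⟩

/-- If all the advice holds forever, the formula with advice implies the formula. -/
theorem sat_of_sat_evalMu {T : Finset (LTL Ap)} {φ : LTL Ap} {w : ℕ → Set Ap}
    (hT : ∀ ψ ∈ T, ψ ∈ sf φ → Sat w (G ψ)) (h : Sat w (evalMu T φ)) : Sat w φ := by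
  induction φ generalizing w with
  | tt | ff | atom a | natom a => exact h
  | conj φ ψ h1 h2 =>
    exact ⟨h1 (fun χ hχ hs => hT χ hχ (by simp [sf, hs])) h.1,
      h2 (fun χ hχ hs => hT χ hχ (by simp [sf, hs])) h.2⟩
  | disj φ ψ h1 h2 =>
    exact h.imp (h1 fun χ hχ hs => hT χ hχ (by simp [sf, hs]))
      (h2 fun χ hχ hs => hT χ hχ (by simp [sf, hs]))
  | X φ h1 => exact h1 (fun χ hχ hs => sat_G_suffix (hT χ hχ (by simp [sf, hs])) _) h
  | F φ h1 =>
    obtain ⟨k, hk⟩ := h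
    exact ⟨k, h1 (fun χ hχ hs => sat_G_suffix (hT χ hχ (by simp [sf, hs])) _) hk⟩
  | G φ h1 =>
    by_cases hm : G φ ∈ T
    · simpa using hT _ hm (self_mem_sf _) 0
    · rw [evalMu, if_neg hm] at h; exact h.elim
  | U φ ψ h1 h2 =>
    have i1 := fun k => h1 (w := wordSuffix w k)
      (fun χ hχ hs => sat_G_suffix (hT χ hχ (by simp [sf, hs])) _)
    have i2 := fun k => h2 (w := wordSuffix w k)
      (fun χ hχ hs => sat_G_suffix (hT χ hχ (by simp [sf, hs])) _)
    obtain ⟨k, hk, hk'⟩ := h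
    exact ⟨k, i2 k hk, fun j hj => i1 j (hk' j hj)⟩
  | M φ ψ h1 h2 =>
    have i1 := fun k => h1 (w := wordSuffix w k)
      (fun χ hχ hs => sat_G_suffix (hT χ hχ (by simp [sf, hs])) _)
    have i2 := fun k => h2 (w := wordSuffix w k)
      (fun χ hχ hs => sat_G_suffix (hT χ hχ (by simp [sf, hs])) _)
    obtain ⟨k, hk, hk'⟩ := h
    exact ⟨k, i1 k hk, fun j hj => i2 j (hk' j hj)⟩
  | W φ ψ h1 h2 =>
    have i1 := fun k => h1 (w := wordSuffix w k)
      (fun χ hχ hs => sat_G_suffix (hT χ hχ (by simp [sf, hs])) _)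
    have i2 := fun k => h2 (w := wordSuffix w k)
      (fun χ hχ hs => sat_G_suffix (hT χ hχ (by simp [sf, hs])) _)
    by_cases hm : W φ ψ ∈ T
    · simpa using hT _ hm (self_mem_sf _) 0
    · rw [evalMu, if_neg hm] at h
      obtain ⟨k, hk, hk'⟩ := h
      exact .inr ⟨k, i2 k hk, fun j hj => i1 j (hk' j hj)⟩
  | R φ ψ h1 h2 =>
    have i1 := fun k => h1 (w := wordSuffix w k)
      (fun χ hχ hs => sat_G_suffix (hT χ hχ (by simp [sf, hs])) _)
    have i2 := fun k => h2 (w := wordSuffix w k)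
      (fun χ hχ hs => sat_G_suffix (hT χ hχ (by simp [sf, hs])) _)
    by_cases hm : R φ ψ ∈ T
    · simpa using hT _ hm (self_mem_sf _) 0
    · rw [evalMu, if_neg hm] at h
      obtain ⟨k, hk, hk'⟩ := h
      exact .inr ⟨k, i1 k hk, fun j hj => i2 j (hk' j hj)⟩

/-! ### Decomposition of the language of a formula -/

theorem not_isMu_and_isNu {φ : LTL Ap} : ¬ (IsMu φ ∧ IsNu φ) := by
  rintro ⟨h1, h2⟩
  cases φ <;> first | exact h1 | exact h2

theorem eventually_sat_G {w : ℕ → Set Ap} {φ : LTL Ap} (h : Sat w (F (G φ))) :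
    ∀ᶠ i in atTop, Sat (wordSuffix w i) (G φ) := by
  obtain ⟨k, hk⟩ := h
  refine eventually_atTop.2 ⟨k, fun b hb => ?_⟩
  obtain ⟨c, rfl⟩ := Nat.exists_eq_add_of_le hb
  simpa using sat_G_suffix hk c

theorem eventually_sat_F_imp (w : ℕ → Set Ap) (φ : LTL Ap) :
    ∀ᶠ i in atTop, Sat (wordSuffix w i) (F φ) → Sat w (G (F φ)) := by
  by_cases h : Sat w (G (F φ))
  · exact Eventually.of_forall fun _ _ => h
  · rw [sat_GF_iff_frequently, not_frequently] at h
    obtain ⟨N, hN⟩ := eventually_atTop.1 h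
    refine eventually_atTop.2 ⟨N, fun b hb ⟨k, hk⟩ => ?_⟩
    exact absurd (by simpa using hk) (hN (b + k) (by omega))

/-- Advice that passes the mutual check of `L2` and `L3` is sound. The check of a formula uses
advice about shorter formulas only, since formulas in `S` and in `T` have different roots; hence
there is no circularity. -/
theorem sat_GF_and_sat_FG_of_mem {S T : Finset (LTL Ap)} (hS : ∀ ψ ∈ S, IsMu ψ)
    (hT : ∀ ψ ∈ T, IsNu ψ) {w : ℕ → Set Ap} (h2 : w ∈ L2 S T) (h3 : w ∈ L3 S T) :
    (∀ ψ ∈ S, Sat w (G (F ψ))) ∧ ∀ ψ ∈ T, Sat w (F (G ψ)) := by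
  suffices ∀ n, ∀ ψ : LTL Ap, ψ.length = n →
      (ψ ∈ S → Sat w (G (F ψ))) ∧ (ψ ∈ T → Sat w (F (G ψ))) from
    ⟨fun ψ => (this _ ψ rfl).1, fun ψ => (this _ ψ rfl).2⟩
  intro n
  induction n using Nat.strong_induction_on with
  | _ n ih =>
    rintro ψ rfl
    constructor
    · intro hψ
      have hev : ∀ᶠ i in atTop, ∀ χ ∈ T, χ ∈ sf ψ → Sat (wordSuffix w i) (G χ) := by
        refine (eventually_all_finset T).2 fun χ hχ => ?_
        by_cases hm : χ ∈ sf ψ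
        · have hlt : χ.length < ψ.length := (length_lt_of_mem_sf hm).resolve_left
            fun h => not_isMu_and_isNu ⟨hS ψ hψ, h ▸ hT χ hχ⟩
          exact (eventually_sat_G ((ih _ hlt χ rfl).2 hχ)).mono fun i hi _ => hi
        · exact Eventually.of_forall fun i h => absurd h hm
      rw [sat_GF_iff_frequently]
      exact (((sat_GF_iff_frequently _ _).1 (h2 ψ hψ)).and_eventually hev).mono
        fun i hi => sat_of_sat_evalMu hi.2 hi.1
    · intro hψ
      rw [sat_FG_iff_eventually]
      refine ((sat_FG_iff_eventually _ _).1 (h3 ψ hψ)).mono fun i hi =>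
        sat_of_sat_evalNu (fun χ hχ hm => ?_) hi
      have hlt : χ.length < ψ.length := (length_lt_of_mem_sf hm).resolve_left
        fun h => not_isMu_and_isNu ⟨hS χ hχ, h ▸ hT ψ hψ⟩
      exact (sat_suffix_GF_iff _ _ _).2 ((ih _ hlt χ rfl).1 hχ)

/-- With sound advice, the condition `L1` gives back `φ`. -/
theorem sat_of_mem_L {φ : LTL Ap} {S T : Finset (LTL Ap)} (hS : S ⊆ mu φ) (hT : T ⊆ nu φ)
    {w : ℕ → Set Ap} (h1 : w ∈ L1 φ S) (h2 : w ∈ L2 S T) (h3 : w ∈ L3 S T) : Sat w φ := by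
  obtain ⟨i, hi⟩ := h1
  refine (sat_afWord_iff w φ i).1 (sat_of_sat_evalNu (fun ψ hψ _ => ?_) hi)
  exact (sat_suffix_GF_iff _ _ _).2 ((sat_GF_and_sat_FG_of_mem
    (fun ψ hψ => (Finset.mem_filter.1 (hS hψ)).2) (fun ψ hψ => (Finset.mem_filter.1 (hT hψ)).2)
    h2 h3).1 ψ hψ)

/-- The true advice consists of the least-fixed-point subformulas that hold infinitely often and
of the greatest-fixed-point subformulas that hold from some point on. -/
theorem exists_mem_L {φ : LTL Ap} {w : ℕ → Set Ap} (h : Sat w φ) :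
    ∃ S ⊆ mu φ, ∃ T ⊆ nu φ, w ∈ L1 φ S ∧ w ∈ L2 S T ∧ w ∈ L3 S T := by
  set S := (mu φ).filter fun ψ => Sat w (G (F ψ)) with hS
  set T := (nu φ).filter fun ψ => Sat w (F (G ψ)) with hT
  have hev : ∀ᶠ i in atTop, ∀ ψ ∈ mu φ, Sat (wordSuffix w i) (F ψ) → ψ ∈ S := by
    refine (eventually_all_finset _).2 fun ψ hψ => ?_
    exact (eventually_sat_F_imp w ψ).mono fun i hi hF => Finset.mem_filter.2 ⟨hψ, hi hF⟩
  refine ⟨S, Finset.filter_subset _ _, T, Finset.filter_subset _ _, ?_, ?_, ?_⟩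
  · obtain ⟨i, hi⟩ := hev.exists
    refine ⟨i, sat_evalNu_of_sat (fun ψ hψ hm => hi ψ ?_) ((sat_afWord_iff w φ i).2 h)⟩
    exact Finset.mem_filter.2 ⟨mem_sf_of_mem_sf_afWord hψ hm, hm⟩
  · intro ψ hψ
    obtain ⟨hm, hGF⟩ := Finset.mem_filter.1 hψ
    rw [sat_GF_iff_frequently] at hGF ⊢
    refine hGF.mono fun i hi => sat_evalMu_of_sat (fun χ hχ hn hFG => ?_) hi
    exact Finset.mem_filter.2 ⟨Finset.mem_filter.2
      ⟨sf_subset_of_mem (Finset.mem_filter.1 hm).1 hχ, hn⟩, (sat_suffix_FG_iff _ _ _).1 hFG⟩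
  · intro ψ hψ
    obtain ⟨hn, hFG⟩ := Finset.mem_filter.1 hψ
    rw [sat_FG_iff_eventually] at hFG ⊢
    filter_upwards [hFG, hev] with i hi hi'
    refine sat_evalNu_of_sat (fun χ hχ hm => hi' χ ?_) hi
    exact Finset.mem_filter.2 ⟨sf_subset_of_mem (Finset.mem_filter.1 hn).1 hχ, hm⟩

/-! ### The number of reachable classes -/

/-- The truth value of `φ` as a propositional formula is a function of the truth values of the
formulas in `P`. -/
def DeterminedBy (P : Finset (LTL Ap)) (φ : LTL Ap) : Prop :=
  ∀ v v' : LTL Ap → Prop, (∀ χ ∈ P, (evalP v χ ↔ evalP v' χ)) → (evalP v φ ↔ evalP v' φ)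

namespace DeterminedBy

variable {P : Finset (LTL Ap)} {φ ψ : LTL Ap}

theorem of_mem (h : φ ∈ P) : DeterminedBy P φ := fun _ _ hv => hv φ h

theorem tt : DeterminedBy P tt := fun _ _ _ => Iff.rfl

theorem ff : DeterminedBy P ff := fun _ _ _ => Iff.rfl

theorem conj (h1 : DeterminedBy P φ) (h2 : DeterminedBy P ψ) : DeterminedBy P (conj φ ψ) :=
  fun v v' hv => and_congr (h1 v v' hv) (h2 v v' hv)

theorem disj (h1 : DeterminedBy P φ) (h2 : DeterminedBy P ψ) : DeterminedBy P (disj φ ψ) :=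
  fun v v' hv => or_congr (h1 v v' hv) (h2 v v' hv)

theorem of_cls_eq (h : cls φ = cls ψ) (h' : DeterminedBy P φ) : DeterminedBy P ψ := by
  rw [cls_eq_cls_iff] at h
  exact fun v v' hv => by rw [← h, ← h, h' v v' hv]

/-- The property of being determined by `P` is preserved by `af` if it is so on `P`. -/
theorem af (hP : ∀ χ ∈ P, ∀ ν, DeterminedBy P (af χ ν)) (h : DeterminedBy P φ) (ν : Set Ap) :
    DeterminedBy P (LTL.af φ ν) := fun v v' hv => by
  rw [evalP_af, evalP_af v']
  refine h _ _ fun χ hχ => ?_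
  rw [← evalP_af, ← evalP_af v']
  exact hP χ hχ ν v v' hv

theorem afWord (hP : ∀ χ ∈ P, ∀ ν, DeterminedBy P (LTL.af χ ν)) (h : DeterminedBy P φ)
    (u : List (Set Ap)) : DeterminedBy P (LTL.afWord φ u) := by
  induction u generalizing φ with
  | nil => exact h
  | cons a u ih => exact ih (h.af hP a)

theorem evalNu (S : Finset (LTL Ap)) (h : DeterminedBy P φ) :
    DeterminedBy (P.image (evalNu S)) (evalNu S φ) := fun v v' hv => by
  rw [evalP_evalNu, evalP_evalNu v']
  refine h _ _ fun χ hχ => ?_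
  rw [← evalP_evalNu, ← evalP_evalNu v']
  exact hv _ (Finset.mem_image_of_mem _ hχ)

end DeterminedBy

/-- A class of formulas determined by `P` amounts to a set of assignments to `P`. -/
theorem finite_and_card_le {P : Finset (LTL Ap)} {K : Set (PropClass Ap)}
    (hK : ∀ c ∈ K, ∃ φ, c = cls φ ∧ DeterminedBy P φ) :
    Finite K ∧ Nat.card K ≤ 2 ^ 2 ^ P.card := by
  choose f hf hd using hK
  let g : K → Set (Set P) := fun c => {A | ∃ v, (∀ χ : P, χ ∈ A ↔ evalP v χ) ∧ evalP v (f c c.2)}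
  have key : ∀ c c' : K, g c = g c' → ∀ v, evalP v (f c c.2) → evalP v (f c' c'.2) := by
    intro c c' h v hv
    have hm : {χ : P | evalP v χ} ∈ g c := ⟨v, fun χ => Iff.rfl, hv⟩
    rw [h] at hm
    obtain ⟨v', hv', h'⟩ := hm
    exact (hd c' c'.2 v v' fun χ hχ => hv' ⟨χ, hχ⟩).2 h'
  have hg : Function.Injective g := by
    intro c c' h
    refine Subtype.ext ?_
    rw [hf c c.2, hf c' c'.2, cls_eq_cls_iff]
    exact fun v => ⟨key c c' h v, key c' c h.symm v⟩
  refine ⟨Finite.of_injective g hg, (Nat.card_le_card_of_injective g hg).trans_eq ?_⟩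
  simp [Nat.card_eq_fintype_card, Fintype.card_set]

/-- The formulas `ψ[S]_ν`, for subformulas `ψ` of `φ`, generate what is reachable from `φ[S]_ν`
propositionally. They need not be proper: some of them are constants, which does no harm. -/
theorem determinedBy_image_evalNu_af (S : Finset (LTL Ap)) (φ : LTL Ap) (ν : Set Ap)
    {P : Finset (LTL Ap)} (hP : ∀ ψ ∈ sf φ, evalNu S ψ ∈ P) :
    DeterminedBy P (af (evalNu S φ) ν) := by
  have h0 := DeterminedBy.of_mem (hP _ (self_mem_sf φ))
  induction φ with
  | tt => exact .tt
  | ff => exact .ff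
  | atom a => simp only [evalNu, af]; split_ifs <;> first | exact .tt | exact .ff
  | natom a => simp only [evalNu, af]; split_ifs <;> first | exact .tt | exact .ff
  | conj φ ψ h1 h2 | disj φ ψ h1 h2 =>
    have i1 := h1 (fun χ hχ => hP χ (by simp [sf, hχ])) (.of_mem (hP _ (by simp [sf, self_mem_sf])))
    have i2 := h2 (fun χ hχ => hP χ (by simp [sf, hχ])) (.of_mem (hP _ (by simp [sf, self_mem_sf])))
    first | exact i1.conj i2 | exact i1.disj i2
  | X φ h1 => exact .of_mem (hP _ (by simp [sf, self_mem_sf]))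
  | F φ h1 => simp only [evalNu]; split_ifs <;> first | exact .tt | exact .ff
  | G φ h1 =>
    have i1 := h1 (fun χ hχ => hP χ (by simp [sf, hχ])) (.of_mem (hP _ (by simp [sf, self_mem_sf])))
    exact i1.conj h0
  | W φ ψ h1 h2 =>
    have i1 := h1 (fun χ hχ => hP χ (by simp [sf, hχ])) (.of_mem (hP _ (by simp [sf, self_mem_sf])))
    have i2 := h2 (fun χ hχ => hP χ (by simp [sf, hχ])) (.of_mem (hP _ (by simp [sf, self_mem_sf])))
    exact i2.disj (i1.conj h0)
  | R φ ψ h1 h2 =>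
    have i1 := h1 (fun χ hχ => hP χ (by simp [sf, hχ])) (.of_mem (hP _ (by simp [sf, self_mem_sf])))
    have i2 := h2 (fun χ hχ => hP χ (by simp [sf, hχ])) (.of_mem (hP _ (by simp [sf, self_mem_sf])))
    exact i2.conj (i1.disj h0)
  | U φ ψ h1 h2 =>
    have i1 := h1 (fun χ hχ => hP χ (by simp [sf, hχ])) (.of_mem (hP _ (by simp [sf, self_mem_sf])))
    have i2 := h2 (fun χ hχ => hP χ (by simp [sf, hχ])) (.of_mem (hP _ (by simp [sf, self_mem_sf])))
    simp only [evalNu] at h0 ⊢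
    split_ifs at h0 ⊢
    · exact i2.disj (i1.conj h0)
    · exact .ff
  | M φ ψ h1 h2 =>
    have i1 := h1 (fun χ hχ => hP χ (by simp [sf, hχ])) (.of_mem (hP _ (by simp [sf, self_mem_sf])))
    have i2 := h2 (fun χ hχ => hP χ (by simp [sf, hχ])) (.of_mem (hP _ (by simp [sf, self_mem_sf])))
    simp only [evalNu] at h0 ⊢
    split_ifs at h0 ⊢
    · exact i2.conj (i1.disj h0)
    · exact .ff

theorem determinedBy_sf_af {P : Finset (LTL Ap)} {φ : LTL Ap} (hP : sf φ ⊆ P) (ν : Set Ap) :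
    DeterminedBy P (af φ ν) := by
  have h0 := DeterminedBy.of_mem (hP (self_mem_sf φ))
  induction φ with
  | tt => exact .tt
  | ff => exact .ff
  | atom a => simp only [af]; split_ifs <;> first | exact .tt | exact .ff
  | natom a => simp only [af]; split_ifs <;> first | exact .tt | exact .ff
  | X φ h1 => exact .of_mem (hP (show φ ∈ sf (X φ) by simp [sf, self_mem_sf]))
  | F φ h1 | G φ h1 =>
    have s1 : sf φ ⊆ P := fun χ hχ => hP (by simp [sf, hχ])
    have i1 := h1 s1 (.of_mem (s1 (self_mem_sf _)))
    first | exact i1.conj h0 | exact i1.disj h0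
  | conj φ ψ h1 h2 | disj φ ψ h1 h2 | U φ ψ h1 h2 | W φ ψ h1 h2 | M φ ψ h1 h2 | R φ ψ h1 h2 =>
    have s1 : sf φ ⊆ P := fun χ hχ => hP (by simp [sf, hχ])
    have s2 : sf ψ ⊆ P := fun χ hχ => hP (by simp [sf, hχ])
    have i1 := h1 s1 (.of_mem (s1 (self_mem_sf _)))
    have i2 := h2 s2 (.of_mem (s2 (self_mem_sf _)))
    first
      | exact i1.conj i2
      | exact i1.disj i2
      | exact i2.disj (i1.conj h0)
      | exact i2.conj (i1.disj h0)

theorem card_sf_le (φ : LTL Ap) : (sf φ).card ≤ φ.length := by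
  induction φ with
  | tt | ff | atom a | natom a => simp [sf, length]
  | X φ h | F φ h | G φ h =>
    simp only [sf, length]
    exact (Finset.card_insert_le _ _).trans (by omega)
  | conj φ ψ h1 h2 | disj φ ψ h1 h2 | U φ ψ h1 h2 | W φ ψ h1 h2 | M φ ψ h1 h2 | R φ ψ h1 h2 =>
    simp only [sf, length]
    have := Finset.card_union_le (sf φ) (sf ψ)
    exact (Finset.card_insert_le _ _).trans (by omega)

theorem length_evalNu_le (S : Finset (LTL Ap)) (φ : LTL Ap) :
    (evalNu S φ).length ≤ φ.length := by
  induction φ <;> simp only [evalNu] <;> (try split_ifs) <;> simp only [length] <;> omega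

theorem length_evalMu_le (T : Finset (LTL Ap)) (φ : LTL Ap) :
    (evalMu T φ).length ≤ φ.length := by
  induction φ <;> simp only [evalMu] <;> (try split_ifs) <;> simp only [length] <;> omega

theorem one_le_length (φ : LTL Ap) : 1 ≤ φ.length := by
  cases φ <;> simp only [length] <;> omega

theorem reach_determinedBy (φ : LTL Ap) :
    ∀ c ∈ Reach φ, ∃ ψ, c = cls ψ ∧ DeterminedBy (sf φ) ψ := by
  rintro c ⟨u, rfl⟩
  exact ⟨_, rfl, (DeterminedBy.of_mem (self_mem_sf φ)).afWord
    (fun χ hχ ν => determinedBy_sf_af (sf_subset_of_mem hχ) ν) u⟩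

theorem reachNu_determinedBy (S : Finset (LTL Ap)) (φ : LTL Ap) :
    ∀ c ∈ ReachNu S φ, ∃ ψ, c = cls ψ ∧ DeterminedBy ((sf φ).image (evalNu S)) ψ := by
  rintro c ⟨ψ, hψ, u, rfl⟩
  refine ⟨_, rfl, DeterminedBy.afWord (fun χ hχ ν => ?_) (DeterminedBy.evalNu S ?_) u⟩
  · obtain ⟨θ, hθ, rfl⟩ := Finset.mem_image.1 hχ
    exact determinedBy_image_evalNu_af S θ ν
      fun ψ hψ => Finset.mem_image_of_mem _ (sf_subset_of_mem hθ hψ)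
  · obtain ⟨θ, hθ, hd⟩ := reach_determinedBy φ _ hψ
    exact hd.of_cls_eq hθ.symm

instance finite_reach (φ : LTL Ap) : Finite (Reach φ) :=
  (finite_and_card_le (reach_determinedBy φ)).1

instance finite_reachNu (S : Finset (LTL Ap)) (φ : LTL Ap) : Finite (ReachNu S φ) :=
  (finite_and_card_le (reachNu_determinedBy S φ)).1

theorem card_reach_le {φ : LTL Ap} {n : ℕ} (h : φ.length ≤ n) :
    Nat.card (Reach φ) ≤ 2 ^ 2 ^ n :=
  (finite_and_card_le (reach_determinedBy φ)).2.trans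
    (Nat.pow_le_pow_right two_pos (Nat.pow_le_pow_right two_pos ((card_sf_le φ).trans h)))

theorem card_reachNu_le (S : Finset (LTL Ap)) (φ : LTL Ap) :
    Nat.card (ReachNu S φ) ≤ 2 ^ 2 ^ φ.length :=
  (finite_and_card_le (reachNu_determinedBy S φ)).2.trans
    (Nat.pow_le_pow_right two_pos (Nat.pow_le_pow_right two_pos
      (Finset.card_image_le.trans (card_sf_le φ))))

/-! ### Sizes of the automata -/

theorem length_le_of_mem_sf {φ ψ : LTL Ap} (h : ψ ∈ sf φ) : ψ.length ≤ φ.length :=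
  (length_lt_of_mem_sf h).elim (fun h => h ▸ le_rfl) le_of_lt

theorem card_mu_add_card_nu_le (φ : LTL Ap) : (mu φ).card + (nu φ).card ≤ φ.length := by
  have hd : Disjoint (mu φ) (nu φ) := Finset.disjoint_left.2 fun ψ h1 h2 =>
    not_isMu_and_isNu ⟨(Finset.mem_filter.1 h1).2, (Finset.mem_filter.1 h2).2⟩
  rw [← Finset.card_union_of_disjoint hd]
  exact (Finset.card_le_card (Finset.union_subset (Finset.filter_subset _ _)
    (Finset.filter_subset _ _))).trans (card_sf_le φ)

theorem card_advice_le (φ : LTL Ap) : (advice φ).card ≤ 2 ^ φ.length := by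
  rw [advice, Finset.card_product, Finset.card_powerset, Finset.card_powerset, ← pow_add]
  exact Nat.pow_le_pow_right two_pos (card_mu_add_card_nu_le φ)

theorem card_pi_le {ι : Type u} [Fintype ι] {Q : ι → Type u} {b : ℕ}
    (h : ∀ i, Nat.card (Q i) ≤ b) : Nat.card (∀ i, Q i) ≤ b ^ Fintype.card ι := by
  rw [Nat.card_pi]
  exact Finset.prod_le_pow_card _ _ _ fun i _ => h i

theorem card_St1_le (φ : LTL Ap) (S : Finset (LTL Ap)) :
    Nat.card (St1 φ S) ≤ (2 ^ 2 ^ φ.length) ^ 2 := by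
  rw [Nat.card_prod, sq]
  exact Nat.mul_le_mul (card_reach_le le_rfl) (card_reachNu_le S φ)

theorem two_pow_pow_pow_le {n k : ℕ} (hk : k ≤ n) :
    (2 ^ 2 ^ (n + 1)) ^ k ≤ 2 ^ 2 ^ (2 * n + 1) := by
  rw [← pow_mul]
  refine Nat.pow_le_pow_right two_pos ?_
  calc 2 ^ (n + 1) * k ≤ 2 ^ (n + 1) * 2 ^ n :=
        Nat.mul_le_mul_left _ (hk.trans Nat.lt_two_pow_self.le)
    _ = 2 ^ (2 * n + 1) := by rw [← pow_add]; congr 1; omega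

theorem card_St2_le {φ : LTL Ap} {S : Finset (LTL Ap)} (hS : S ⊆ mu φ) (T : Finset (LTL Ap)) :
    Nat.card (St2 S T) ≤ 2 ^ 2 ^ (4 * φ.length) := by
  have hn := one_le_length φ
  have hc : S.card ≤ φ.length :=
    (Finset.card_le_card (hS.trans (Finset.filter_subset _ _))).trans (card_sf_le φ)
  have h1 : Nat.card (∀ ψ : S, Reach (F (evalMu T ψ.1))) ≤ 2 ^ 2 ^ (2 * φ.length + 1) := by
    refine (card_pi_le (b := 2 ^ 2 ^ (φ.length + 1)) fun ψ => card_reach_le ?_).trans ?_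
    · have := length_le_of_mem_sf (Finset.mem_filter.1 (hS ψ.2)).1
      have := length_evalMu_le T ψ.1
      simp only [length]; omega
    · rw [Fintype.card_coe]; exact two_pow_pow_pow_le hc
  rw [Nat.card_prod, Nat.card_fin]
  have h2 : S.card - 1 + 1 ≤ 2 ^ 2 ^ φ.length :=
    calc S.card - 1 + 1 ≤ φ.length := by omega
      _ ≤ 2 ^ φ.length := Nat.lt_two_pow_self.le
      _ ≤ 2 ^ 2 ^ φ.length := Nat.pow_le_pow_right two_pos Nat.lt_two_pow_self.le
  refine (Nat.mul_le_mul h1 h2).trans ?_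
  rw [← pow_add]
  refine Nat.pow_le_pow_right two_pos ?_
  calc 2 ^ (2 * φ.length + 1) + 2 ^ φ.length
      ≤ 2 ^ (2 * φ.length + 1) + 2 ^ (2 * φ.length + 1) :=
        Nat.add_le_add_left (Nat.pow_le_pow_right two_pos (by omega)) _
    _ = 2 ^ (2 * φ.length + 2) := by ring
    _ ≤ 2 ^ (4 * φ.length) := Nat.pow_le_pow_right two_pos (by omega)

theorem card_St3_le {φ : LTL Ap} (S : Finset (LTL Ap)) {T : Finset (LTL Ap)} (hT : T ⊆ nu φ) :
    Nat.card (St3 S T) ≤ 2 ^ 2 ^ (4 * φ.length) := by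
  have hn := one_le_length φ
  have hc : T.card ≤ φ.length :=
    (Finset.card_le_card (hT.trans (Finset.filter_subset _ _))).trans (card_sf_le φ)
  refine (card_pi_le (b := 2 ^ 2 ^ (φ.length + 1)) fun ψ => card_reach_le ?_).trans ?_
  · have := length_le_of_mem_sf (Finset.mem_filter.1 (hT ψ.2)).1
    have := length_evalNu_le S ψ.1
    simp only [length]; omega
  · rw [Fintype.card_coe]
    exact (two_pow_pow_pow_le hc).trans
      (Nat.pow_le_pow_right two_pos (Nat.pow_le_pow_right two_pos (by omega)))

theorem card_StPair_le {φ : LTL Ap} {S T : Finset (LTL Ap)} (hS : S ⊆ mu φ) (hT : T ⊆ nu φ) :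
    Nat.card (StPair φ S T) ≤ 2 ^ 2 ^ (6 * φ.length) := by
  have hn := one_le_length φ
  rw [Nat.card_prod, Nat.card_prod (St2 S T)]
  refine (Nat.mul_le_mul (card_St1_le φ S)
    (Nat.mul_le_mul (card_St2_le hS T) (card_St3_le S hT))).trans ?_
  rw [← pow_mul, ← pow_add, ← pow_add]
  refine Nat.pow_le_pow_right two_pos ?_
  have h1 : 2 ^ φ.length ≤ 2 ^ (4 * φ.length) := Nat.pow_le_pow_right two_pos (by omega)
  calc 2 ^ φ.length * 2 + (2 ^ (4 * φ.length) + 2 ^ (4 * φ.length))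
      ≤ 2 ^ (4 * φ.length + 2) := by rw [pow_add]; omega
    _ ≤ 2 ^ (6 * φ.length) := Nat.pow_le_pow_right two_pos (by omega)

theorem mem_advice {φ : LTL Ap} {p : Finset (LTL Ap) × Finset (LTL Ap)} :
    p ∈ advice φ ↔ p.1 ⊆ mu φ ∧ p.2 ⊆ nu φ := by
  simp [advice]

theorem card_StDRA_le (φ : LTL Ap) : Nat.card (StDRA φ) ≤ 2 ^ 2 ^ (7 * φ.length) := by
  refine (card_pi_le (b := 2 ^ 2 ^ (6 * φ.length)) fun p =>
    card_StPair_le (mem_advice.1 p.2).1 (mem_advice.1 p.2).2).trans ?_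
  rw [Fintype.card_coe]
  calc (2 ^ 2 ^ (6 * φ.length)) ^ (advice φ).card
      ≤ (2 ^ 2 ^ (6 * φ.length)) ^ 2 ^ φ.length :=
        Nat.pow_le_pow_right (by positivity) (card_advice_le φ)
    _ = 2 ^ 2 ^ (7 * φ.length) := by rw [← pow_mul, ← pow_add]; congr 2; omega

/-! ### Languages of the automata -/

/-- The monitored formula at position `j` is what remains of `φ` there, with the advice. A restart
at the position `n` already consumes the letter at `n`. -/
theorem eventually_not_mem_rej1_iff (φ : LTL Ap) (S : Finset (LTL Ap)) (w : ℕ → Set Ap) :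
    (∀ᶠ n in atTop, (pre1 φ S).run w n ∉ rej1 φ S) ↔ w ∈ L1 φ S := by
  have hfst : ∀ n, ((pre1 φ S).run w n).1.1 = cls (afWord φ (wordPrefix w n)) := by
    intro n
    induction n with
    | zero => rfl
    | succ n ih =>
      rw [afWord_wordPrefix_succ]
      exact congrArg (fun c => afCls c (w n)) ih
  refine eventually_ne_ff_iff w (fun j => evalNu S (afWord φ (wordPrefix w j)))
    (fun j => isNuLTL_evalNu S _) (fun j h => ?_) (fun n => ((pre1 φ S).run w n).2.1) rfl
    (fun n hn => ⟨n, 1, le_rfl, rfl, ?_⟩) (fun n hn => ?_)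
  · have := sat_evalNu_af S _ h
    rw [wordSuffix_wordSuffix] at this
    rw [afWord_wordPrefix_succ]
    exact this
  · simp only [DetPre.run, pre1] at hn ⊢
    rw [if_pos hn]
    exact congrArg (fun c => afCls (evalNuCls S c) (w n)) (hfst n)
  · simp only [DetPre.run, pre1] at hn ⊢
    rw [if_neg hn]

theorem frequently_mem_acc2_iff (S T : Finset (LTL Ap)) (w : ℕ → Set Ap) :
    (∃ᶠ n in atTop, (pre2 S T).run w n ∈ acc2 S T) ↔ w ∈ L2 S T := by
  rw [pre2, acc2, DetPre.frequently_counterAcc_iff]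
  simp only [frequently_mem_gfAcc_iff _ (isMuLTL_evalMu T _)]
  exact Subtype.forall

theorem eventually_not_mem_rej3_iff (S T : Finset (LTL Ap)) (w : ℕ → Set Ap) :
    (∀ᶠ n in atTop, (pre3 S T).run w n ∉ rej3 S T) ↔ w ∈ L3 S T := by
  simp only [pre3, rej3, Set.mem_ofPred_eq, not_exists, DetPre.run_pi, eventually_all,
    eventually_not_mem_fgRej_iff _ (isNuLTL_evalNu S _)]
  exact Subtype.forall

theorem language_aut1 (φ : LTL Ap) (S : Finset (LTL Ap)) : (aut1 φ S).language = L1 φ S := by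
  ext w
  rw [aut1, DetPre.mem_language_withAcc, AccCond.holds_fin_iff, eventually_not_mem_rej1_iff]

theorem language_aut2 (S T : Finset (LTL Ap)) : (aut2 S T).language = L2 S T := by
  ext w
  rw [aut2, DetPre.mem_language_withAcc, AccCond.holds_inf_iff, frequently_mem_acc2_iff]

theorem language_aut3 (S T : Finset (LTL Ap)) : (aut3 S T).language = L3 S T := by
  ext w
  rw [aut3, DetPre.mem_language_withAcc, AccCond.holds_fin_iff, eventually_not_mem_rej3_iff]

theorem rabinPair_holds_iff (φ : LTL Ap) (S T : Finset (LTL Ap)) (w : ℕ → Set Ap) :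
    ((∃ᶠ n in atTop, (prePair φ S T).run w n ∈ (rabinPair φ S T).1) ∧
      ∀ᶠ n in atTop, (prePair φ S T).run w n ∉ (rabinPair φ S T).2) ↔
      w ∈ L1 φ S ∩ L2 S T ∩ L3 S T := by
  simp only [prePair, DetPre.run_prod3, rabinPair, Set.mem_ofPred_eq, Set.mem_union, not_or,
    eventually_and, frequently_mem_acc2_iff, eventually_not_mem_rej1_iff,
    eventually_not_mem_rej3_iff, Set.mem_inter_iff]
  tauto

theorem language_autPair (φ : LTL Ap) (S T : Finset (LTL Ap)) :
    (autPair φ S T).language = L1 φ S ∩ L2 S T ∩ L3 S T := by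
  ext w
  rw [autPair, DetPre.mem_language_withAcc, AccCond.holds_rabin_iff, ← rabinPair_holds_iff]
  simp

theorem language_dra (φ : LTL Ap) :
    (dra φ).language = ⋃ p ∈ advice φ, (autPair φ p.1 p.2).language := by
  ext w
  rw [dra, DetPre.mem_language_withAcc, AccCond.holds_rabin_iff]
  have key : ∀ p : advice φ, w ∈ (autPair φ p.1.1 p.1.2).language ↔
      (∃ᶠ n in atTop, (DetPre.pi fun p : advice φ => prePair φ p.1.1 p.1.2).run w n p ∈
        (rabinPair φ p.1.1 p.1.2).1) ∧
      ∀ᶠ n in atTop, (DetPre.pi fun p : advice φ => prePair φ p.1.1 p.1.2).run w n p ∉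
        (rabinPair φ p.1.1 p.1.2).2 := fun p => by
    simp only [DetPre.run_pi, rabinPair_holds_iff, language_autPair]
  simp only [Set.mem_iUnion]
  constructor
  · rintro ⟨q, hq, h⟩
    obtain ⟨p, -, rfl⟩ := List.mem_map.1 hq
    exact ⟨p.1, p.2, (key p).2 h⟩
  · rintro ⟨p, hp, h⟩
    exact ⟨_, List.mem_map.2 ⟨⟨p, hp⟩, by simp, rfl⟩, (key ⟨p, hp⟩).1 h⟩

theorem iUnion_language_autPair (φ : LTL Ap) :
    ⋃ p ∈ advice φ, (autPair φ p.1 p.2).language = φ.lang := by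
  ext w
  simp only [language_autPair, Set.mem_iUnion, exists_prop]
  constructor
  · rintro ⟨p, hp, ⟨h1, h2⟩, h3⟩
    exact sat_of_mem_L (mem_advice.1 hp).1 (mem_advice.1 hp).2 h1 h2 h3
  · intro h
    obtain ⟨S, hS, T, hT, h1, h2, h3⟩ := exists_mem_L h
    exact ⟨(S, T), mem_advice.2 ⟨hS, hT⟩, ⟨h1, h2⟩, h3⟩

theorem isDRA_dra (φ : LTL Ap) : (dra φ).IsDRA (advice φ).card := by
  refine ⟨inferInstance, DetPre.isDeterministic_withAcc _ _, _, ?_, ?_, rfl⟩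
  · exact Finset.card_pos.2 ⟨(∅, ∅), mem_advice.2 ⟨by simp, by simp⟩⟩
  · simp

end LTL

end

theorem mainTheorem3 :
    ∃ C : ℕ, ∀ (Ap : Type u) (φ : LTL Ap),
      (∀ S T : Finset (LTL Ap), S ⊆ φ.mu → T ⊆ φ.nu →
        -- the formula/advice-switching coBüchi automaton
        ((LTL.aut1 φ S).IsDCA ∧
          (LTL.aut1 φ S).language = LTL.L1 φ S ∧
          Nat.card (LTL.St1 φ S) ≤ (2 ^ 2 ^ φ.length) ^ 2) ∧
        -- the Büchi automaton
        ((LTL.aut2 S T).IsDBA ∧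
          (LTL.aut2 S T).language = LTL.L2 S T ∧
          Nat.card (LTL.St2 S T) ≤ 2 ^ 2 ^ (C * φ.length)) ∧
        -- the second coBüchi automaton
        ((LTL.aut3 S T).IsDCA ∧
          (LTL.aut3 S T).language = LTL.L3 S T ∧
          Nat.card (LTL.St3 S T) ≤ 2 ^ 2 ^ (C * φ.length)) ∧
        -- their product, a Rabin automaton with one Rabin pair
        ((LTL.autPair φ S T).IsDRA 1 ∧
          (LTL.autPair φ S T).language = LTL.L1 φ S ∩ LTL.L2 S T ∩ LTL.L3 S T ∧
          Nat.card (LTL.StPair φ S T) ≤ 2 ^ 2 ^ (C * φ.length))) ∧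
      -- the Rabin automaton for the formula
      (∃ k ≤ 2 ^ φ.length, (LTL.dra φ).IsDRA k) ∧
      (LTL.dra φ).language = ⋃ p ∈ LTL.advice φ, (LTL.autPair φ p.1 p.2).language ∧
      (LTL.dra φ).language = φ.lang ∧
      Nat.card (LTL.StDRA φ) ≤ 2 ^ 2 ^ (C * φ.length) := by
  have mono : ∀ {Ap : Type u} (φ : LTL Ap) {a b : ℕ}, a ≤ b →
      2 ^ 2 ^ (a * φ.length) ≤ 2 ^ 2 ^ (b * φ.length) := fun φ a b h =>
    Nat.pow_le_pow_right two_pos (Nat.pow_le_pow_right two_pos (Nat.mul_le_mul_right _ h))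
  refine ⟨7, fun Ap φ => ⟨fun S T hS hT => ⟨?_, ?_, ?_, ?_⟩, ?_, ?_, ?_, ?_⟩⟩
  · exact ⟨⟨inferInstance, DetPre.isDeterministic_withAcc _ _, _, rfl⟩,
      LTL.language_aut1 φ S, LTL.card_St1_le φ S⟩
  · exact ⟨⟨inferInstance, DetPre.isDeterministic_withAcc _ _, _, rfl⟩,
      LTL.language_aut2 S T, (LTL.card_St2_le hS T).trans (mono φ (by norm_num))⟩
  · exact ⟨⟨inferInstance, DetPre.isDeterministic_withAcc _ _, _, rfl⟩,
      LTL.language_aut3 S T, (LTL.card_St3_le S hT).trans (mono φ (by norm_num))⟩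
  · exact ⟨⟨inferInstance, DetPre.isDeterministic_withAcc _ _, _, le_rfl, rfl, rfl⟩,
      LTL.language_autPair φ S T, (LTL.card_StPair_le hS hT).trans (mono φ (by norm_num))⟩
  · exact ⟨_, LTL.card_advice_le φ, LTL.isDRA_dra φ⟩
  · exact LTL.language_dra φ
  · exact (LTL.language_dra φ).trans (LTL.iUnion_language_autPair φ)
  · exact LTL.card_StDRA_le φ
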